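/- Let $\Omega\subset\mathbb R^2$ be a bounded open set (for example a bounded simply connected smooth domain), let $L>0$, $D=\Omega\times(0,L)$, $h_0\ge 0$, $\vec e_3=(0,0,1)$ and $\vec a(x)=\frac12(-x_2,x_1,0)$. For a vector field $\vec A=(A^1,A^2,A^3)$ on $\mathbb R^3$ write $\hat A=(A^1,A^2)$; for $v=(v^1,v^2)$ on $D$ write $\operatorname{curl}v=\partial_1v^2-\partial_2v^1$ in the sense of distributions; $\nabla\times$ and $\nabla\cdot$ are also taken in the weak sense. Let $\mathcal M(D)$ be the space of finite signed Radon measures on $D$, let $\check H^1(\mathbb R^3;\mathbb R^3)$ be the completion of $C_c^\infty(\mathbb R^3;\mathbb R^3)$ with respect to $\|\vec C\|=\big(\int_{\mathbb R^3}|\nabla\vec C|^2dx\big)^{1/2}$, and set $$V=\{v\in L^2(D;\mathbb R^2):\operatorname{curl}v\in\mathcal M(D)\},$$ $$E_0=\{\vec C\in H^1_{loc}(\mathbb R^3;\mathbb R^3):\nabla\times\vec C-h_0\vec e_3\in L^2(\mathbb R^3;\mathbb R^3)\},$$ $$K_0=\{\vec C\in E_0:\nabla\cdot\vec C=0,\ \vec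 C-h_0\vec a\in\check H^1(\mathbb R^3;\mathbb R^3)\cap L^6(\mathbb R^3;\mathbb R^3)\}.$$ For $(v,\vec A)\in L^2(D;\mathbb R^2)\times E_0$ define $$\mathcal G_{h_0}(v,\vec A)=\frac12\Big[\|v-\hat A\|_{L^2(D)}^2+|\operatorname{curl}v|(D)+\|\nabla\times\vec A-h_0\vec e_3\|_{L^2(\mathbb R^3)}^2\Big],$$ where $|\operatorname{curl}v|(D)$ is the total variation of the measure $\operatorname{curl}v$, and is $+\infty$ if $\operatorname{curl}v\notin\mathcal M(D)$. Then $\mathcal G_{h_0}$ attains its minimum over $V\times E_0$ and its minimum over $V\times K_0$, both minima are finite, and $$\min_{V\times E_0}\mathcal G_{h_0}=\min_{V\times K_0}\mathcal G_{h_0}.$$ -/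

import Mathlib

open MeasureTheory Filter Topology
open scoped ENNReal NNReal ContDiff

noncomputable section

namespace LawrenceDoniach

/-- The plane with its Euclidean structure. -/
abbrev R2 : Type := EuclideanSpace ℝ (Fin 2)

/-- Three-space with its Euclidean structure; the coordinates `x₁, x₂, x₃` are `x 0, x 1, x 2`. -/
abbrev R3 : Type := EuclideanSpace ℝ (Fin 3)

/-- The first two components of a vector of three-space. -/
def hat (y : R3) : R2 := !₂[y 0, y 1]

/-- The third standard basis vector. -/
def e3 : R3 := !₂[0, 0, 1]

/-- The vector field `a(x) = (-x₂, x₁, 0) / 2`, whose curl is `e3`. -/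
def aField (x : R3) : R3 := !₂[-(x 1) / 2, x 0 / 2, 0]

/-- The cylinder `Ω × (0, L)`. -/
def cylinder (Ω : Set R2) (L : ℝ) : Set R3 := {x | hat x ∈ Ω ∧ 0 < x 2 ∧ x 2 < L}

/-- The classical partial derivative `∂ᵢ φ`. -/
def partialDeriv (i : Fin 3) (φ : R3 → ℝ) (x : R3) : ℝ :=
  fderiv ℝ φ x (EuclideanSpace.single i 1)

/-- Test functions on `U`: smooth with compact support contained in `U`. -/
def IsTestFunction (U : Set R3) (φ : R3 → ℝ) : Prop :=
  ContDiff ℝ ∞ φ ∧ HasCompactSupport φ ∧ tsupport φ ⊆ U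

/-- `g` is a weak (distributional) `i`-th partial derivative of `f` on the whole space. -/
def HasWeakPartial (i : Fin 3) (f g : R3 → ℝ) : Prop :=
  LocallyIntegrable f volume ∧ LocallyIntegrable g volume ∧
    ∀ φ : R3 → ℝ, IsTestFunction Set.univ φ →
      ∫ x, f x * partialDeriv i φ x = -∫ x, g x * φ x

open Classical in
/-- The weak `i`-th partial derivative of `f` (determined up to a null set), with the value `0`
if `f` has none. -/
def weakPartial (i : Fin 3) (f : R3 → ℝ) : R3 → ℝ :=
  if h : ∃ g, HasWeakPartial i f g then h.choose else 0

/-- The space `L²_loc(ℝ³)`. -/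
def MemL2loc (f : R3 → ℝ) : Prop :=
  ∀ K : Set R3, IsCompact K → MemLp f 2 (volume.restrict K)

/-- The space `H¹_loc(ℝ³; ℝ³)`: each component and each of its weak first partial derivatives is
locally square integrable. -/
def MemH1loc (C : R3 → R3) : Prop :=
  ∀ j : Fin 3, MemL2loc (fun x => C x j) ∧
    ∀ i : Fin 3, ∃ g : R3 → ℝ, MemL2loc g ∧ HasWeakPartial i (fun x => C x j) g

/-- The weak partial derivative `∂ᵢ Cʲ` of a vector field. -/
def weakJac (C : R3 → R3) (i j : Fin 3) : R3 → ℝ := weakPartial i (fun x => C x j)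

/-- The (weak) curl of a vector field on three-space. -/
def curl (C : R3 → R3) (x : R3) : R3 :=
  !₂[weakJac C 1 2 x - weakJac C 2 1 x,
     weakJac C 2 0 x - weakJac C 0 2 x,
     weakJac C 0 1 x - weakJac C 1 0 x]

/-- The (weak) divergence of a vector field on three-space. -/
def divergence (C : R3 → R3) (x : R3) : ℝ := ∑ i, weakJac C i i x

/-- The vector fields that represent an element of the completion of `C_c^∞(ℝ³; ℝ³)` with respect
to the seminorm `(∫ |∇C|²)^(1/2)`: weakly differentiable fields whose gradient is the limit in `L²`
of the gradients of a sequence of smooth compactly supported fields. The seminorm does not see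
constants; intersecting with `L⁶`, as is done below, fixes the additive constant. -/
def MemHcheck (C : R3 → R3) : Prop :=
  (∀ i j : Fin 3, ∃ g : R3 → ℝ, HasWeakPartial i (fun x => C x j) g) ∧
  ∃ ψ : ℕ → R3 → R3,
    (∀ n, ContDiff ℝ ∞ (ψ n) ∧ HasCompactSupport (ψ n)) ∧
    Tendsto (fun n => ∫⁻ x, ∑ i, ∑ j,
        ‖partialDeriv i (fun y => ψ n y j) x - weakJac C i j x‖ₑ ^ 2) atTop (𝓝 0)

/-- The space `E₀` of admissible magnetic potentials. -/
def spaceE (h₀ : ℝ) : Set (R3 → R3) :=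
  {C | MemH1loc C ∧ MemLp (fun x => curl C x - h₀ • e3) 2 volume}

/-- The space `K₀` of admissible magnetic potentials in the Coulomb gauge. -/
def spaceK (h₀ : ℝ) : Set (R3 → R3) :=
  {C | C ∈ spaceE h₀ ∧ divergence C =ᵐ[volume] 0 ∧
    MemHcheck (fun x => C x - h₀ • aField x) ∧
    MemLp (fun x => C x - h₀ • aField x) 6 volume}

/-- The integral of a function against a finite signed measure. -/
def integralSigned {X : Type*} [MeasurableSpace X] (μ : SignedMeasure X) (f : X → ℝ) : ℝ :=
  ∫ x, f x ∂μ.toJordanDecomposition.posPart - ∫ x, f x ∂μ.toJordanDecomposition.negPart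

/-- The finite signed Borel measure `μ` on the open set `D` is the distributional planar curl
`∂₁ v² - ∂₂ v¹` of `v : D → ℝ²`. (Finite Borel measures on an open subset of `ℝ³` are Radon.) -/
def IsCurlMeasure (D : Set R3) (v : R3 → R2) (μ : SignedMeasure D) : Prop :=
  ∀ φ : R3 → ℝ, IsTestFunction D φ →
    integralSigned μ (fun x : D => φ x) =
      ∫ x in D, (v x 0 * partialDeriv 1 φ x - v x 1 * partialDeriv 0 φ x)

/-- The space `V` of square integrable planar fields on `D` whose planar curl is a finite Radon
measure on `D`. -/
def spaceV (D : Set R3) : Set (R3 → R2) :=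
  {v | MemLp v 2 (volume.restrict D) ∧ ∃ μ : SignedMeasure D, IsCurlMeasure D v μ}

/-- The total variation `|curl v|(D)` of the measure `curl v`. There is at most one measure `μ`
over which the infimum is taken, and the value is `+∞` if `curl v` is not a finite Radon measure. -/
def curlVariation (D : Set R3) (v : R3 → R2) : ℝ≥0∞ :=
  ⨅ (μ : SignedMeasure D) (_ : IsCurlMeasure D v μ), μ.totalVariation Set.univ

/-- The limiting functional `½ (‖v - Â‖²_{L²(D)} + |curl v|(D) + ‖∇ × A - h₀ e₃‖²_{L²(ℝ³)})`. -/
def limitEnergy (D : Set R3) (h₀ : ℝ) (p : (R3 → R2) × (R3 → R3)) : ℝ≥0∞ :=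
  2⁻¹ * ((∫⁻ x in D, ‖p.1 x - hat (p.2 x)‖ₑ ^ 2) + curlVariation D p.1 +
    ∫⁻ x, ‖curl p.2 x - h₀ • e3‖ₑ ^ 2)

end LawrenceDoniach

end

namespace LawrenceDoniach

/-! The energy sees `(v, A)` only through `w = v - Â`, `B = ∇ × A - h₀ e₃` and the measure `curl v`.
These data obey linear constraints: `B` is divergence free, and `curl v = curl w + B₃ + h₀` on `D`.
Conversely, any data obeying them come from a pair `(v, A)` with `A` in Coulomb gauge. Hence
minimizing over `E₀`, over `K₀`, or over the reduced data (`Admissible`, `reducedEnergy`) is the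
same problem, and no gauge fixing of a minimizing sequence is needed.

The reduced problem is solved by the direct method. Bounded energy gives weak limits of `w` and `B`
in `L²` (`exists_weak_limit_L2`) and vague limits of the positive and negative parts of `curl v`
(`exists_measure_tendsto_ultrafilter`). The constraints are tested against smooth functions, so they
survive, and each term of the energy is lower semicontinuous.

The return from `B` to `A` (`exists_coulomb_potential`) solves `ΔC = -curl B` weakly. Each component
of `C` has as gradient the projection of an `L²` field onto the closure of test gradients
(`exists_gradient_part`), and the Sobolev inequality puts the potential in `L⁶`. Then `div C` and
`curl C - B` are square integrable and harmonic, hence zero by Liouville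
(`ae_eq_zero_of_integral_mul_laplacian`). Finally `A = C + h₀ a` and `v = w + Â`. -/

/-! ### Test functions and weak derivatives -/

theorem isTestFunction_univ {φ : R3 → ℝ} :
    IsTestFunction Set.univ φ ↔ ContDiff ℝ ∞ φ ∧ HasCompactSupport φ := by
  simp [IsTestFunction]

theorem IsTestFunction.mono {U V : Set R3} {φ : R3 → ℝ} (h : IsTestFunction U φ) (hUV : U ⊆ V) :
    IsTestFunction V φ := ⟨h.1, h.2.1, h.2.2.trans hUV⟩

theorem IsTestFunction.univ {U : Set R3} {φ : R3 → ℝ} (h : IsTestFunction U φ) :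
    IsTestFunction Set.univ φ := h.mono (Set.subset_univ _)

theorem contDiff_partialDeriv {i : Fin 3} {φ : R3 → ℝ} (h : ContDiff ℝ ∞ φ) :
    ContDiff ℝ ∞ (partialDeriv i φ) :=
  (h.fderiv_right (m := ∞) (by simp)).clm_apply contDiff_const

theorem IsTestFunction.partialDeriv {U : Set R3} {φ : R3 → ℝ} (h : IsTestFunction U φ)
    (i : Fin 3) : IsTestFunction U (partialDeriv i φ) :=
  ⟨contDiff_partialDeriv h.1, h.2.1.fderiv_apply ℝ _,
    (tsupport_fderiv_apply_subset ℝ _).trans h.2.2⟩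

theorem IsTestFunction.continuous {U : Set R3} {φ : R3 → ℝ} (h : IsTestFunction U φ) :
    Continuous φ := h.1.continuous

theorem IsTestFunction.memLp {U : Set R3} {φ : R3 → ℝ} (h : IsTestFunction U φ) (p : ℝ≥0∞) :
    MemLp φ p volume := h.continuous.memLp_of_hasCompactSupport h.2.1

theorem IsTestFunction.integrable_mul {U : Set R3} {f φ : R3 → ℝ} (h : IsTestFunction U φ)
    (hf : LocallyIntegrable f volume) : Integrable (fun x => f x * φ x) := by
  simpa [mul_comm] using hf.integrable_smul_left_of_hasCompactSupport h.continuous h.2.1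

theorem partialDeriv_comm {φ : R3 → ℝ} (h : ContDiff ℝ ∞ φ) (i j : Fin 3) :
    partialDeriv i (partialDeriv j φ) = partialDeriv j (partialDeriv i φ) := by
  have key : ∀ (i j : Fin 3) (x : R3), partialDeriv i (partialDeriv j φ) x =
      fderiv ℝ (fderiv ℝ φ) x (EuclideanSpace.single i 1) (EuclideanSpace.single j 1) := by
    intro i j x
    have hd : DifferentiableAt ℝ (fderiv ℝ φ) x :=
      ((h.fderiv_right (m := ∞) (by simp)).differentiable (by simp)) x
    change fderiv ℝ (fun y => fderiv ℝ φ y (EuclideanSpace.single j 1)) x _ = _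
    rw [fderiv_clm_apply hd (by fun_prop)]
    simp
  funext x
  rw [key, key]
  exact ((contDiff_infty.1 h 2).contDiffAt.isSymmSndFDerivAt (by simp)) _ _

theorem integral_mul_partialDeriv {g φ : R3 → ℝ} (hg : ContDiff ℝ 1 g)
    (hφ : IsTestFunction Set.univ φ) (i : Fin 3) :
    ∫ x, g x * partialDeriv i φ x = -∫ x, partialDeriv i g x * φ x := by
  have hg' : Continuous (partialDeriv i g) :=
    (hg.continuous_fderiv (by simp)).clm_apply continuous_const
  apply integral_mul_fderiv_eq_neg_fderiv_mul_of_integrable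
  · exact hφ.integrable_mul hg'.locallyIntegrable
  · exact (hφ.partialDeriv i).integrable_mul hg.continuous.locallyIntegrable
  · exact hφ.integrable_mul hg.continuous.locallyIntegrable
  · exact fun x _ => hg.differentiable (by simp) x
  · exact fun x _ => hφ.1.differentiable (by simp) x

theorem HasWeakPartial.of_contDiff {g : R3 → ℝ} (hg : ContDiff ℝ 1 g) (i : Fin 3) :
    HasWeakPartial i g (LawrenceDoniach.partialDeriv i g) :=
  ⟨hg.continuous.locallyIntegrable,
    ((hg.continuous_fderiv (by simp)).clm_apply continuous_const).locallyIntegrable,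
    fun _ hφ => integral_mul_partialDeriv hg hφ i⟩

theorem HasWeakPartial.add {i : Fin 3} {f g f' g' : R3 → ℝ} (h : HasWeakPartial i f g)
    (h' : HasWeakPartial i f' g') :
    HasWeakPartial i (fun x => f x + f' x) (fun x => g x + g' x) := by
  refine ⟨h.1.add h'.1, h.2.1.add h'.2.1, fun φ hφ => ?_⟩
  simp only [add_mul]
  rw [integral_add ((hφ.partialDeriv i).integrable_mul h.1)
    ((hφ.partialDeriv i).integrable_mul h'.1), integral_add (hφ.integrable_mul h.2.1)
    (hφ.integrable_mul h'.2.1), h.2.2 φ hφ, h'.2.2 φ hφ, neg_add]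

/-- Makes the arbitrary choice in `weakPartial` harmless: any explicit weak derivative may replace
it almost everywhere. -/
theorem HasWeakPartial.ae_eq {i : Fin 3} {f g g' : R3 → ℝ} (h : HasWeakPartial i f g)
    (h' : HasWeakPartial i f g') : g =ᵐ[volume] g' := by
  apply ae_eq_of_integral_contDiff_smul_eq h.2.1 h'.2.1
  intro φ h1 h2
  have hφ : IsTestFunction Set.univ φ := isTestFunction_univ.2 ⟨h1, h2⟩
  have := (h.2.2 φ hφ).symm.trans (h'.2.2 φ hφ)
  simpa [mul_comm] using this

theorem HasWeakPartial.weakPartial {i : Fin 3} {f g : R3 → ℝ} (h : HasWeakPartial i f g) :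
    HasWeakPartial i f (weakPartial i f) := by
  have h' : ∃ g, HasWeakPartial i f g := ⟨g, h⟩
  unfold LawrenceDoniach.weakPartial
  rw [dif_pos h']
  exact h'.choose_spec

theorem HasWeakPartial.weakPartial_ae_eq {i : Fin 3} {f g : R3 → ℝ} (h : HasWeakPartial i f g) :
    LawrenceDoniach.weakPartial i f =ᵐ[volume] g := h.weakPartial.ae_eq h

theorem partialDeriv_clm (i : Fin 3) (l : R3 →L[ℝ] ℝ) (x : R3) :
    partialDeriv i l x = l (EuclideanSpace.single i 1) := by
  simp [partialDeriv]

/-! ### Gradients of test functions -/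

/-- The gradient, assembled from the partial derivatives. -/
noncomputable def grad (φ : R3 → ℝ) (x : R3) : R3 := WithLp.toLp 2 fun i => partialDeriv i φ x

@[simp] theorem grad_apply (φ : R3 → ℝ) (x : R3) (i : Fin 3) :
    grad φ x i = partialDeriv i φ x := rfl

theorem fderiv_apply_eq_inner_grad (φ : R3 → ℝ) (x v : R3) :
    fderiv ℝ φ x v = inner ℝ (grad φ x) v := by
  have hv : v = ∑ i, v i • EuclideanSpace.single i (1 : ℝ) := by
    ext j; simp [Fin.sum_univ_three]; fin_cases j <;> simp
  conv_lhs => rw [hv]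
  simp [PiLp.inner_apply, partialDeriv, map_sum]

theorem norm_fderiv_le_norm_grad (φ : R3 → ℝ) (x : R3) : ‖fderiv ℝ φ x‖ ≤ ‖grad φ x‖ := by
  refine ContinuousLinearMap.opNorm_le_bound _ (norm_nonneg _) fun v => ?_
  rw [fderiv_apply_eq_inner_grad]
  exact norm_inner_le_norm _ _

theorem continuous_grad {φ : R3 → ℝ} (h : ContDiff ℝ 1 φ) : Continuous (grad φ) := by
  refine (PiLp.continuous_toLp 2 _).comp (continuous_pi fun i => ?_)
  exact (h.continuous_fderiv (by simp)).clm_apply continuous_const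

theorem hasCompactSupport_grad {φ : R3 → ℝ} (h : HasCompactSupport φ) :
    HasCompactSupport (grad φ) := by
  have h1 : HasCompactSupport (fderiv ℝ φ) := h.fderiv ℝ
  refine h1.mono' (subset_closure.trans' fun x hx => ?_)
  contrapose! hx
  simp only [Function.mem_support, not_not] at hx ⊢
  ext i
  simp [partialDeriv, hx]

theorem IsTestFunction.memLp_grad {U : Set R3} {φ : R3 → ℝ} (h : IsTestFunction U φ) (p : ℝ≥0∞) :
    MemLp (grad φ) p volume :=
  (continuous_grad (h.1.of_le (by simp))).memLp_of_hasCompactSupport (hasCompactSupport_grad h.2.1)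

theorem IsTestFunction.sub {U : Set R3} {φ ψ : R3 → ℝ} (h : IsTestFunction U φ)
    (h' : IsTestFunction U ψ) : IsTestFunction U (fun x => φ x - ψ x) := by
  refine ⟨h.1.sub h'.1, h.2.1.sub h'.2.1, ?_⟩
  exact (tsupport_sub _ _).trans (Set.union_subset h.2.2 h'.2.2)

theorem IsTestFunction.add {U : Set R3} {φ ψ : R3 → ℝ} (h : IsTestFunction U φ)
    (h' : IsTestFunction U ψ) : IsTestFunction U (fun x => φ x + ψ x) :=
  ⟨h.1.add h'.1, h.2.1.add h'.2.1, (tsupport_add _ _).trans (Set.union_subset h.2.2 h'.2.2)⟩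

theorem IsTestFunction.const_mul {U : Set R3} {φ : R3 → ℝ} (h : IsTestFunction U φ) (c : ℝ) :
    IsTestFunction U (fun x => c * φ x) :=
  ⟨contDiff_const.mul h.1, h.2.1.mul_left, (tsupport_mul_subset_right).trans h.2.2⟩

theorem grad_add {φ ψ : R3 → ℝ} (h : ContDiff ℝ 1 φ) (h' : ContDiff ℝ 1 ψ) (x : R3) :
    grad (fun x => φ x + ψ x) x = grad φ x + grad ψ x := by
  ext i
  simp [partialDeriv, fderiv_fun_add (h.differentiable (by simp) x) (h'.differentiable (by simp) x)]

theorem grad_const_mul {φ : R3 → ℝ} (c : ℝ) (h : ContDiff ℝ 1 φ) (x : R3) :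
    grad (fun x => c * φ x) x = c • grad φ x := by
  ext i
  simp [partialDeriv, fderiv_const_mul (h.differentiable (by simp) x)]

/-! ### The Laplacian and Liouville's theorem in `L²` -/

/-- The Laplacian. -/
noncomputable def laplacian (φ : R3 → ℝ) (x : R3) : ℝ := ∑ i, partialDeriv i (partialDeriv i φ) x

theorem contDiff_laplacian {φ : R3 → ℝ} (h : ContDiff ℝ ∞ φ) : ContDiff ℝ ∞ (laplacian φ) :=
  ContDiff.sum fun _ _ => contDiff_partialDeriv (contDiff_partialDeriv h)

theorem hasCompactSupport_laplacian {U : Set R3} {φ : R3 → ℝ}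
    (h : IsTestFunction U φ) : HasCompactSupport (laplacian φ) := by
  have : laplacian φ = fun x => partialDeriv 0 (partialDeriv 0 φ) x +
      partialDeriv 1 (partialDeriv 1 φ) x + partialDeriv 2 (partialDeriv 2 φ) x := by
    funext x; simp [laplacian, Fin.sum_univ_three]
  rw [this]
  exact ((((h.partialDeriv 0).partialDeriv 0).add ((h.partialDeriv 1).partialDeriv 1)).add
    ((h.partialDeriv 2).partialDeriv 2)).2.1

theorem integral_mul_laplacian_eq_sum {f φ : R3 → ℝ} (hf : LocallyIntegrable f volume)
    (hφ : IsTestFunction Set.univ φ) :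
    ∫ x, f x * laplacian φ x = ∑ i, ∫ x, f x * partialDeriv i (partialDeriv i φ) x := by
  simp only [laplacian, Finset.mul_sum]
  exact integral_finsetSum _ fun i _ => ((hφ.partialDeriv i).partialDeriv i).integrable_mul hf

theorem integral_mul_laplacian {g φ : R3 → ℝ} (hg : ContDiff ℝ ∞ g)
    (hφ : IsTestFunction Set.univ φ) :
    ∫ x, g x * laplacian φ x = ∫ x, laplacian g x * φ x := by
  rw [integral_mul_laplacian_eq_sum hg.continuous.locallyIntegrable hφ]
  simp only [laplacian, Finset.sum_mul]
  rw [integral_finsetSum _ fun i _ => hφ.integrable_mul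
    (contDiff_partialDeriv (contDiff_partialDeriv hg)).continuous.locallyIntegrable]
  refine Finset.sum_congr rfl fun i _ => ?_
  rw [integral_mul_partialDeriv (hg.of_le (by simp)) (hφ.partialDeriv i),
    integral_mul_partialDeriv ((contDiff_partialDeriv hg).of_le (by simp)) hφ, neg_neg]

theorem partialDeriv_mul {f g : R3 → ℝ} (hf : ContDiff ℝ ∞ f) (hg : ContDiff ℝ ∞ g) (i : Fin 3)
    (x : R3) : partialDeriv i (fun y => f y * g y) x =
      f x * partialDeriv i g x + g x * partialDeriv i f x := by
  simp [partialDeriv, fderiv_fun_mul (hf.differentiable (by simp) x)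
    (hg.differentiable (by simp) x)]

/-- For harmonic `u` the last term drops, so integrating `u²` against the Laplacian of a cutoff
controls the Dirichlet energy of `u`. -/
theorem laplacian_mul_self {u : R3 → ℝ} (hu : ContDiff ℝ ∞ u) (x : R3) :
    laplacian (fun y => u y * u y) x = 2 * ‖grad u x‖ ^ 2 + 2 * (u x * laplacian u x) := by
  have hd : ∀ i, ContDiff ℝ ∞ (partialDeriv i u) := fun i => contDiff_partialDeriv hu
  have key : ∀ i, partialDeriv i (partialDeriv i fun y => u y * u y) x =
      2 * partialDeriv i u x ^ 2 + 2 * (u x * partialDeriv i (partialDeriv i u) x) := by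
    intro i
    have h1 : (partialDeriv i fun y => u y * u y) =
        fun y => (u y + u y) * partialDeriv i u y := by
      funext y; rw [partialDeriv_mul hu hu]; ring
    rw [h1, partialDeriv_mul (hu.add hu) (hd i)]
    have : partialDeriv i (fun y => u y + u y) x = partialDeriv i u x + partialDeriv i u x := by
      simp [partialDeriv, fderiv_fun_add (hu.differentiable (by simp) x)
        (hu.differentiable (by simp) x)]
    rw [this]; ring
  simp only [laplacian, key, EuclideanSpace.norm_sq_eq, grad_apply, Real.norm_eq_abs, sq_abs,
    Finset.mul_sum, Finset.sum_add_distrib]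

theorem partialDeriv_comp_smul (c : ℝ) (φ : R3 → ℝ) (i : Fin 3) (x : R3) :
    partialDeriv i (fun y => φ (c • y)) x = c * partialDeriv i φ (c • x) := by
  simp [partialDeriv, fderiv_comp_smul]

theorem laplacian_comp_smul (c : ℝ) {φ : R3 → ℝ} (hφ : ContDiff ℝ ∞ φ) (x : R3) :
    laplacian (fun y => φ (c • y)) x = c ^ 2 * laplacian φ (c • x) := by
  have h1 : ∀ i, (partialDeriv i fun y => φ (c • y)) =
      fun y => c * partialDeriv i φ (c • y) := fun i => funext (partialDeriv_comp_smul c φ i)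
  simp only [laplacian, h1, Finset.mul_sum]
  refine Finset.sum_congr rfl fun i _ => ?_
  have h2 : ContDiff ℝ ∞ (fun y : R3 => partialDeriv i φ (c • y)) :=
    (contDiff_partialDeriv hφ).comp (contDiff_const_smul c)
  have h3 : partialDeriv i (fun y => c * partialDeriv i φ (c • y)) x =
      c * partialDeriv i (fun y => partialDeriv i φ (c • y)) x := by
    rw [partialDeriv, fderiv_const_mul (h2.differentiable (by simp) x)]; rfl
  rw [h3, partialDeriv_comp_smul]; ring

/-- A smooth square integrable harmonic function on the whole space vanishes. -/
theorem eq_zero_of_laplacian_eq_zero {u : R3 → ℝ} (hu : ContDiff ℝ ∞ u) (hL : MemLp u 2 volume)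
    (h0 : ∀ x, laplacian u x = 0) : u = 0 := by
  -- Rescaled, this gives cutoffs `η n` equal to 1 on the ball of radius `n + 1` and vanishing
  -- outside radius `2 (n + 1)`, whose Laplacians are `O(n⁻²)`.
  let b : ContDiffBump (0 : R3) := ⟨1, 2, by norm_num, by norm_num⟩
  have hb : IsTestFunction Set.univ b := isTestFunction_univ.2 ⟨b.contDiff, b.hasCompactSupport⟩
  obtain ⟨M, hM⟩ := (contDiff_laplacian hb.1).continuous.bounded_above_of_compact_support
    (hasCompactSupport_laplacian hb)
  have hM0 : 0 ≤ M := (norm_nonneg _).trans (hM 0)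
  let η : ℕ → R3 → ℝ := fun n x => b (((n : ℝ) + 1)⁻¹ • x)
  have hpos : ∀ n : ℕ, (0 : ℝ) < n + 1 := fun n => by positivity
  have hη : ∀ n, IsTestFunction Set.univ (η n) := fun n => isTestFunction_univ.2
    ⟨hb.1.comp (contDiff_const_smul _), hb.2.1.comp_smul (inv_pos.2 (hpos n)).ne'⟩
  have hη0 : ∀ n x, 0 ≤ η n x := fun n x => b.nonneg
  have hgc : Continuous fun x => ‖grad u x‖ ^ 2 := (continuous_grad (hu.of_le (by simp))).norm.pow 2
  have hsq : Integrable (fun x => u x * u x) volume := by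
    simpa [pow_two] using hL.integrable_sq
  -- Caccioppoli estimate: two integrations by parts move the Laplacian from `η n` to `u²`. The
  -- factor 2 gained is thrown away.
  have hbound : ∀ n, ∫ x, ‖grad u x‖ ^ 2 * η n x ≤
      ((n : ℝ) + 1)⁻¹ ^ 2 * (M * ∫ x, u x * u x) := by
    intro n
    have h1 : ∫ x, (u x * u x) * laplacian (η n) x = 2 * ∫ x, ‖grad u x‖ ^ 2 * η n x := by
      rw [integral_mul_laplacian (hu.mul hu) (hη n), ← integral_const_mul]
      refine integral_congr_ae (Eventually.of_forall fun x => ?_)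
      simp only [laplacian_mul_self hu, h0]; ring
    have h2 : ∫ x, (u x * u x) * laplacian (η n) x ≤
        ∫ x, ((n : ℝ) + 1)⁻¹ ^ 2 * (M * (u x * u x)) := by
      refine integral_mono ?_ ((hsq.const_mul M).const_mul _) fun x => ?_
      · simpa [mul_comm] using (hu.mul hu).continuous.locallyIntegrable.integrable_smul_left_of_hasCompactSupport
          (contDiff_laplacian (hη n).1).continuous (hasCompactSupport_laplacian (hη n))
      · have h3 := (le_abs_self _).trans (hM (((n : ℝ) + 1)⁻¹ • x))
        have h4 : laplacian (η n) x = _ := laplacian_comp_smul _ hb.1 x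
        change u x * u x * laplacian (η n) x ≤ _
        rw [h4]
        have h5 : (0 : ℝ) ≤ ((n : ℝ) + 1)⁻¹ ^ 2 * (u x * u x) :=
          mul_nonneg (by positivity) (mul_self_nonneg _)
        nlinarith [mul_le_mul_of_nonneg_left h3 h5]
    rw [integral_const_mul, integral_const_mul] at h2
    have h6 : 0 ≤ ∫ x, ‖grad u x‖ ^ 2 * η n x :=
      integral_nonneg fun x => mul_nonneg (by positivity) (hη0 n x)
    linarith
  -- `η n` equals 1 on the support of `η N`, so a fixed cutoff is dominated by all late ones and its
  -- weighted energy inherits their limit 0.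
  have hmono : ∀ N n, 2 * (N + 1) ≤ n →
      ∫ x, ‖grad u x‖ ^ 2 * η N x ≤ ∫ x, ‖grad u x‖ ^ 2 * η n x := by
    intro N n hn
    refine integral_mono ((hη N).integrable_mul hgc.locallyIntegrable)
      ((hη n).integrable_mul hgc.locallyIntegrable) fun x => ?_
    refine mul_le_mul_of_nonneg_left ?_ (by positivity)
    by_cases hx : ‖x‖ ≤ n + 1
    · have : η n x = 1 := by
        apply b.one_of_mem_closedBall
        rw [mem_closedBall_zero_iff, norm_smul, norm_inv, Real.norm_of_nonneg (hpos n).le,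
          inv_mul_le_iff₀ (hpos n)]
        simpa [b] using hx
      rw [this]; exact b.le_one
    · have : η N x = 0 := by
        apply b.zero_of_le_dist
        rw [dist_zero_right, norm_smul, norm_inv, Real.norm_of_nonneg (hpos N).le,
          le_inv_mul_iff₀ (hpos N)]
        have : (2 * (N + 1) : ℝ) ≤ n := by exact_mod_cast hn
        simp only [b]; linarith
      rw [this]; exact hη0 _ _
  have hzero : ∀ N, ∫ x, ‖grad u x‖ ^ 2 * η N x ≤ 0 := by
    intro N
    have ht : Tendsto (fun n : ℕ => ((n : ℝ) + 1)⁻¹ ^ 2 * (M * ∫ x, u x * u x)) atTop (𝓝 0) := by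
      have := (tendsto_one_div_add_atTop_nhds_zero_nat (𝕜 := ℝ)).pow 2 |>.mul_const
        (M * ∫ x, u x * u x)
      simpa using this
    refine ge_of_tendsto ht ?_
    filter_upwards [eventually_ge_atTop (2 * (N + 1))] with n hn
    exact (hmono N n hn).trans (hbound n)
  have hgrad : ∀ x, grad u x = 0 := by
    intro x
    by_contra hx
    obtain ⟨N, hN⟩ := exists_nat_ge ‖x‖
    have h1 : η N x = 1 := by
      apply b.one_of_mem_closedBall
      rw [mem_closedBall_zero_iff, norm_smul, norm_inv, Real.norm_of_nonneg (hpos N).le,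
        inv_mul_le_iff₀ (hpos N)]
      simp only [b]; linarith
    refine (hzero N).not_gt ?_
    refine Continuous.integral_pos_of_hasCompactSupport_nonneg_nonzero (x := x)
      (hgc.mul (hη N).continuous) (hη N).2.1.mul_left
      (fun y => mul_nonneg (by positivity) (hη0 N y)) ?_
    rw [h1]; simpa using hx
  have hconst : ∀ x, u x = u 0 := fun x =>
    is_const_of_fderiv_eq_zero (hu.differentiable (by simp))
      (fun y => by ext v; simp [fderiv_apply_eq_inner_grad, hgrad]) x 0
  have hu' : u = fun _ => u 0 := funext hconst
  rw [hu', memLp_const_iff (by simp) (by simp)] at hL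
  rcases hL with h | h
  · rw [hu', h]; rfl
  · simp at h

theorem eLpNorm_two_sq {α E : Type*} [MeasurableSpace α] [NormedAddCommGroup E] (μ : Measure α)
    (f : α → E) : eLpNorm f 2 μ ^ 2 = ∫⁻ x, ‖f x‖ₑ ^ 2 ∂μ := by
  rw [eLpNorm_eq_lintegral_rpow_enorm_toReal (by simp) (by simp), ← ENNReal.rpow_natCast,
    ← ENNReal.rpow_mul]
  simp

theorem lintegral_mul_sq_le {α : Type*} [MeasurableSpace α] (μ : Measure α) {f g : α → ℝ≥0∞}
    (hf : AEMeasurable f μ) (hg : AEMeasurable g μ) :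
    (∫⁻ a, f a * g a ∂μ) ^ 2 ≤ (∫⁻ a, f a ^ 2 ∂μ) * ∫⁻ a, g a ^ 2 ∂μ := by
  have h := ENNReal.lintegral_mul_le_Lp_mul_Lq μ Real.HolderConjugate.two_two hf hg
  calc _ ≤ ((∫⁻ a, f a ^ (2 : ℝ) ∂μ) ^ (1 / (2 : ℝ)) *
        (∫⁻ a, g a ^ (2 : ℝ) ∂μ) ^ (1 / (2 : ℝ))) ^ 2 := by gcongr; exact h
    _ = _ := by
      rw [mul_pow, ← ENNReal.rpow_natCast, ← ENNReal.rpow_natCast, ← ENNReal.rpow_mul,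
        ← ENNReal.rpow_mul]
      simp

-- Young's inequality for a compactly supported kernel: Cauchy–Schwarz bounds the square of the
-- convolution by the local `L²` mass of `f` over a translate of the reflected support of `φ`, and
-- Tonelli integrates this bound.
open scoped Convolution in
theorem memLp_two_convolution {f φ : R3 → ℝ} (hf : MemLp f 2 volume)
    (hφ : IsTestFunction Set.univ φ) :
    MemLp (f ⋆[ContinuousLinearMap.mul ℝ ℝ, volume] φ) 2 volume := by
  have hloc : LocallyIntegrable f volume := hf.locallyIntegrable (by norm_num)
  refine ⟨(hφ.2.1.contDiff_convolution_right (n := ⊤) _ hloc hφ.1).continuous.aestronglyMeasurable,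
    ?_⟩
  refine ((ENNReal.pow_lt_top_iff (n := 2)).1 ?_).resolve_right (by simp)
  rw [eLpNorm_two_sq]
  set K := tsupport φ with hK
  have hKm : MeasurableSet K := (isClosed_tsupport φ).measurableSet
  set χ : R3 → ℝ≥0∞ := K.indicator 1 with hχ
  have hχm : Measurable χ := measurable_one.indicator hKm
  set A : ℝ≥0∞ := ∫⁻ t, ‖φ t‖ₑ ^ 2 with hA
  have hA' : A < ⊤ := by
    rw [hA, ← eLpNorm_two_sq]; exact ENNReal.pow_lt_top (hφ.memLp 2).2
  have hpt : ∀ y, ‖(f ⋆[ContinuousLinearMap.mul ℝ ℝ, volume] φ) y‖ₑ ^ 2 ≤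
      (∫⁻ t, ‖f t‖ₑ ^ 2 * χ (y - t)) * A := by
    intro y
    have h1 : ‖(f ⋆[ContinuousLinearMap.mul ℝ ℝ, volume] φ) y‖ₑ ≤
        ∫⁻ t, (‖f t‖ₑ * χ (y - t)) * ‖φ (y - t)‖ₑ := by
      refine (enorm_integral_le_lintegral_enorm _).trans (lintegral_mono fun t => ?_)
      rw [ContinuousLinearMap.mul_apply', enorm_mul]
      by_cases ht : y - t ∈ K
      · simp [hχ, ht]
      · simp [image_eq_zero_of_notMem_tsupport ht]
    have hsub : Measurable fun t : R3 => y - t := measurable_const.sub measurable_id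
    refine (pow_le_pow_left' h1 2).trans ((lintegral_mul_sq_le volume
      (hf.1.enorm.mul (hχm.comp hsub).aemeasurable)
      (hφ.continuous.measurable.comp hsub).enorm.aemeasurable).trans ?_)
    have h2 : ∫⁻ t, ‖φ (y - t)‖ₑ ^ 2 = A :=
      lintegral_sub_left_eq_self (fun t => ‖φ t‖ₑ ^ 2) y
    simp only [Function.comp_def]
    rw [h2]
    gcongr with t
    rw [Pi.mul_apply, mul_pow]
    by_cases ht : y - t ∈ K <;> simp [hχ, ht]
  refine (lintegral_mono hpt).trans_lt ?_
  rw [lintegral_mul_const'' _ ?_]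
  · refine ENNReal.mul_lt_top ?_ hA'
    rw [lintegral_lintegral_swap]
    · have h3 : ∀ t, ∫⁻ y, ‖f t‖ₑ ^ 2 * χ (y - t) = ‖f t‖ₑ ^ 2 * volume K := by
        intro t
        have h4 : Measurable fun y => χ (y - t) := hχm.comp (measurable_id.sub_const t)
        rw [lintegral_const_mul _ h4]
        rw [lintegral_sub_right_eq_self χ t, hχ, lintegral_indicator_one hKm]
      simp only [h3]
      rw [lintegral_mul_const'' _ (hf.1.enorm.pow_const 2), ← eLpNorm_two_sq]
      exact ENNReal.mul_lt_top (ENNReal.pow_lt_top hf.2) (IsCompact.measure_lt_top hφ.2.1)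
    · exact ((hf.1.enorm.pow_const 2).comp_snd).mul
        (hχm.comp (measurable_fst.sub measurable_snd)).aemeasurable
  · exact (((hf.1.enorm.pow_const 2).comp_snd).mul
        (hχm.comp (measurable_fst.sub measurable_snd)).aemeasurable).lintegral_prod_right'

theorem partialDeriv_comp_const_sub {φ : R3 → ℝ} (hφ : ContDiff ℝ ∞ φ) (i : Fin 3) (y x : R3) :
    partialDeriv i (fun t => φ (y - t)) x = -partialDeriv i φ (y - x) := by
  have h : HasFDerivAt (fun t => φ (y - t)) _ x :=
    (hφ.differentiable (by simp) (y - x)).hasFDerivAt.comp x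
    ((hasFDerivAt_const y x).sub (hasFDerivAt_id x))
  simp [partialDeriv, h.fderiv]

theorem IsTestFunction.comp_const_sub {φ : R3 → ℝ} (hφ : IsTestFunction Set.univ φ) (y : R3) :
    IsTestFunction Set.univ fun t => φ (y - t) :=
  isTestFunction_univ.2 ⟨hφ.1.comp (contDiff_const.sub contDiff_id),
    hφ.2.1.comp_homeomorph (Homeomorph.subLeft y)⟩

open scoped Convolution in
/-- A square integrable function on the whole space that is harmonic in the sense of distributions
vanishes. -/
theorem ae_eq_zero_of_integral_mul_laplacian {f : R3 → ℝ} (hf : MemLp f 2 volume)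
    (h : ∀ φ, IsTestFunction Set.univ φ → ∫ x, f x * laplacian φ x = 0) : f =ᵐ[volume] 0 := by
  have hloc : LocallyIntegrable f volume := hf.locallyIntegrable (by norm_num)
  -- Mollification reduces to the smooth case: `f ⋆ φ` is smooth, square integrable and harmonic. At
  -- the origin it is the pairing of `f` with the reflected test function, so its vanishing for
  -- every `φ` kills `f`.
  have key : ∀ φ, IsTestFunction Set.univ φ →
      f ⋆[ContinuousLinearMap.mul ℝ ℝ, volume] φ = 0 := by
    intro φ hφ
    have hpd : ∀ ψ, IsTestFunction Set.univ ψ → ∀ i,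
        partialDeriv i (f ⋆[ContinuousLinearMap.mul ℝ ℝ, volume] ψ) =
          f ⋆[ContinuousLinearMap.mul ℝ ℝ, volume] partialDeriv i ψ := by
      intro ψ hψ i
      funext y
      have h1 := hψ.2.1.hasFDerivAt_convolution_right (ContinuousLinearMap.mul ℝ ℝ) hloc
        (hψ.1.of_le (by simp)) y
      rw [partialDeriv, h1.fderiv, convolution_precompR_apply _ hloc (hψ.2.1.fderiv ℝ)
        (hψ.1.continuous_fderiv (by simp))]
      rfl
    refine eq_zero_of_laplacian_eq_zero
      (hφ.2.1.contDiff_convolution_right (n := ⊤) _ hloc hφ.1) (memLp_two_convolution hf hφ) ?_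
    intro y
    rw [← h _ (hφ.comp_const_sub y)]
    rw [integral_mul_laplacian_eq_sum hloc (hφ.comp_const_sub y)]
    refine Finset.sum_congr rfl fun i _ => ?_
    rw [hpd φ hφ, hpd _ (hφ.partialDeriv i), convolution_def]
    refine integral_congr_ae (Eventually.of_forall fun t => ?_)
    have h1 : (partialDeriv i fun t => φ (y - t)) =
      fun t => -partialDeriv i φ (y - t) := funext (partialDeriv_comp_const_sub hφ.1 i y)
    have h2 : ∀ (g : R3 → ℝ), partialDeriv i (fun t => -g t) t = -partialDeriv i g t := by
      intro g; simp [partialDeriv, fderiv_fun_neg]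
    simp only [ContinuousLinearMap.mul_apply', h1, h2,
      partialDeriv_comp_const_sub (contDiff_partialDeriv hφ.1), neg_neg]
  refine ae_eq_zero_of_integral_contDiff_smul_eq_zero hloc fun g hg hg' => ?_
  have h1 := congrFun (key _ ((isTestFunction_univ.2 ⟨hg, hg'⟩ : IsTestFunction _ g).comp_const_sub 0)) 0
  rw [convolution_def] at h1
  simpa [mul_comm] using h1

/-! ### Projection onto gradients -/

theorem tendsto_integral_mul_of_tendsto_eLpNorm {p : ℝ≥0∞} (hp : 1 ≤ p) {f : R3 → ℝ}
    {F : ℕ → R3 → ℝ} (hf : MemLp f p volume) (hF : ∀ n, MemLp (F n) p volume)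
    (h : Tendsto (fun n => eLpNorm (F n - f) p volume) atTop (𝓝 0)) {φ : R3 → ℝ}
    (hφ : IsTestFunction Set.univ φ) :
    Tendsto (fun n => ∫ x, F n x * φ x) atTop (𝓝 (∫ x, f x * φ x)) := by
  have : p.HolderConjugate (ENNReal.conjExponent p) := .conjExponent hp
  refine tendsto_integral_of_L1' _ (hφ.integrable_mul (hf.locallyIntegrable hp)).1
    (Eventually.of_forall fun n => hφ.integrable_mul ((hF n).locallyIntegrable hp)) ?_
  have hle : ∀ n, eLpNorm ((fun x => F n x * φ x) - fun x => f x * φ x) 1 volume ≤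
      eLpNorm (F n - f) p volume * eLpNorm φ (ENNReal.conjExponent p) volume := by
    intro n
    have : ((fun x => F n x * φ x) - fun x => f x * φ x) = (F n - f) • φ := by
      funext x; simp [sub_mul]
    rw [this]
    exact eLpNorm_smul_le_mul_eLpNorm hφ.continuous.aestronglyMeasurable
      ((hF n).1.sub hf.1)
  refine tendsto_of_tendsto_of_tendsto_of_le_of_le tendsto_const_nhds ?_
    (fun n => zero_le) hle
  simpa using ENNReal.Tendsto.mul_const h (Or.inr (hφ.memLp _).2.ne)

/-- Both sides of the defining identity are continuous under norm limits. The two exponents are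
independent because potentials converge in `L⁶` and gradients in `L²`. -/
theorem HasWeakPartial.of_tendsto {p q : ℝ≥0∞} (hp : 1 ≤ p) (hq : 1 ≤ q) {i : Fin 3}
    {f g : R3 → ℝ} {F G : ℕ → R3 → ℝ} (hf : MemLp f p volume) (hF : ∀ n, MemLp (F n) p volume)
    (hg : MemLp g q volume) (hG : ∀ n, MemLp (G n) q volume)
    (hFG : ∀ n, HasWeakPartial i (F n) (G n))
    (h : Tendsto (fun n => eLpNorm (F n - f) p volume) atTop (𝓝 0))
    (h' : Tendsto (fun n => eLpNorm (G n - g) q volume) atTop (𝓝 0)) :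
    HasWeakPartial i f g := by
  refine ⟨hf.locallyIntegrable hp, hg.locallyIntegrable hq, fun φ hφ => ?_⟩
  refine tendsto_nhds_unique
    (tendsto_integral_mul_of_tendsto_eLpNorm hp hf hF h (hφ.partialDeriv i)) ?_
  simp only [fun n => (hFG n).2.2 φ hφ]
  exact (tendsto_integral_mul_of_tendsto_eLpNorm hq hg hG h' hφ).neg

/-- The gradients of test functions, as a subspace of `L²`. -/
def gradSubmodule : Submodule ℝ (Lp R3 2 (volume : Measure R3)) where
  carrier := {x | ∃ φ, ∃ h : IsTestFunction Set.univ φ, x = (h.memLp_grad 2).toLp}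
  add_mem' := by
    rintro _ _ ⟨φ, hφ, rfl⟩ ⟨ψ, hψ, rfl⟩
    refine ⟨_, hφ.add hψ, ?_⟩
    rw [← MemLp.toLp_add]
    congr 1
    funext x
    exact (grad_add (hφ.1.of_le (by simp)) (hψ.1.of_le (by simp)) x).symm
  zero_mem' := by
    have h0 : IsTestFunction Set.univ (fun _ => (0 : ℝ)) :=
      isTestFunction_univ.2 ⟨contDiff_const, HasCompactSupport.zero⟩
    refine ⟨_, h0, ?_⟩
    rw [← MemLp.toLp_zero (MemLp.zero (ε := R3))]
    congr 1
    funext x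
    ext i
    simp [partialDeriv]
  smul_mem' := by
    rintro c _ ⟨φ, hφ, rfl⟩
    refine ⟨_, hφ.const_mul c, ?_⟩
    rw [← MemLp.toLp_const_smul]
    congr 1
    funext x
    exact (grad_const_mul c (hφ.1.of_le (by simp)) x).symm

/-- Gagliardo–Nirenberg–Sobolev in dimension three, where `1/6 = 1/2 - 1/3`. -/
theorem exists_eLpNorm_le_eLpNorm_grad : ∃ c : ℝ≥0, ∀ φ, IsTestFunction Set.univ φ →
    eLpNorm φ 6 volume ≤ c * eLpNorm (grad φ) 2 volume := by
  refine ⟨SNormLESNormFDerivOfEqConst ℝ (volume : Measure R3) 2, fun φ hφ => ?_⟩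
  have h := eLpNorm_le_eLpNorm_fderiv_of_eq (volume : Measure R3) (p := 2) (p' := 6)
    (hφ.1.of_le (by simp)) hφ.2.1 (by norm_num) (by simp) (by simp; norm_num)
  refine h.trans (mul_le_mul_right ?_ _)
  exact eLpNorm_mono (norm_fderiv_le_norm_grad φ)

theorem grad_sub {φ ψ : R3 → ℝ} (h : ContDiff ℝ 1 φ) (h' : ContDiff ℝ 1 ψ) :
    grad (fun x => φ x - ψ x) = grad φ - grad ψ := by
  funext x
  ext i
  simp [partialDeriv, fderiv_fun_sub (h.differentiable (by simp) x)
    (h'.differentiable (by simp) x)]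

/-- The gradient part of a square integrable vector field: it has a potential in `L⁶`, and its
complement is orthogonal to all gradients of test functions. -/
theorem exists_gradient_part {F : R3 → R3} (hF : MemLp F 2 volume) :
    ∃ (u : R3 → ℝ) (g : R3 → R3) (ψ : ℕ → R3 → ℝ), MemLp u 6 volume ∧ MemLp g 2 volume ∧
      (∀ i, HasWeakPartial i u fun x => g x i) ∧ (∀ n, IsTestFunction Set.univ (ψ n)) ∧
      Tendsto (fun n => ∫⁻ x, ‖grad (ψ n) x - g x‖ₑ ^ 2) atTop (𝓝 0) ∧
      ∀ φ, IsTestFunction Set.univ φ → ∫ x, inner ℝ (F x - g x) (grad φ x) = 0 := by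
  have : Fact ((1 : ℝ≥0∞) ≤ 6) := ⟨by norm_num⟩
  set S := gradSubmodule.topologicalClosure with hS
  have : CompleteSpace S := (gradSubmodule.isClosed_topologicalClosure).completeSpace_coe
  set y := S.starProjection hF.toLp with hy
  have hyS : y ∈ closure (gradSubmodule : Set (Lp R3 2 (volume : Measure R3))) := by
    rw [← Submodule.topologicalClosure_coe]
    exact S.starProjection_apply_mem _
  obtain ⟨s, hs, hlim⟩ := mem_closure_iff_seq_limit.1 hyS
  choose ψ hψ hsψ using hs
  obtain ⟨c, hc⟩ := exists_eLpNorm_le_eLpNorm_grad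
  -- The Sobolev inequality applied to differences: convergence of the gradients makes the
  -- potentials themselves Cauchy in `L⁶`, with no constants to subtract.
  have hle : ∀ m n, edist (((hψ m).memLp 6).toLp) (((hψ n).memLp 6).toLp) ≤
      c * edist (s m) (s n) := by
    intro m n
    rw [hsψ, hsψ, Lp.edist_toLp_toLp, Lp.edist_toLp_toLp,
      ← grad_sub ((hψ m).1.of_le (by simp)) ((hψ n).1.of_le (by simp))]
    exact hc _ ((hψ m).sub (hψ n))
  have hcau : CauchySeq fun n => ((hψ n).memLp 6).toLp := by
    rw [Metric.cauchySeq_iff]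
    intro ε hε
    obtain ⟨N, hN⟩ := Metric.cauchySeq_iff.1 hlim.cauchySeq (ε / (c + 1)) (by positivity)
    refine ⟨N, fun m hm n hn => ?_⟩
    have h1 := hN m hm n hn
    have h2 : dist (((hψ m).memLp 6).toLp) (((hψ n).memLp 6).toLp) ≤ c * dist (s m) (s n) := by
      have := ENNReal.toReal_mono (ENNReal.mul_ne_top (by simp) (edist_ne_top _ _)) (hle m n)
      simpa [edist_dist, ENNReal.toReal_mul] using this
    rw [lt_div_iff₀ (by positivity)] at h1
    nlinarith [dist_nonneg (x := s m) (y := s n)]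
  obtain ⟨u, hu⟩ := cauchySeq_tendsto_of_complete hcau
  have hu' : Tendsto (fun n => eLpNorm (ψ n - (u : R3 → ℝ)) 6 volume) atTop (𝓝 0) := by
    rw [← Lp.toLp_coeFn u (Lp.memLp u)] at hu
    exact (Lp.tendsto_Lp_iff_tendsto_eLpNorm'' _ _ _ _).1 hu
  have hg' : Tendsto (fun n => eLpNorm (grad (ψ n) - (y : R3 → R3)) 2 volume) atTop (𝓝 0) := by
    rw [funext hsψ, ← Lp.toLp_coeFn y (Lp.memLp y)] at hlim
    exact (Lp.tendsto_Lp_iff_tendsto_eLpNorm'' _ _ _ _).1 hlim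
  refine ⟨u, y, ψ, Lp.memLp u, Lp.memLp y, fun i => ?_, hψ, ?_, fun φ hφ => ?_⟩
  · refine HasWeakPartial.of_tendsto (p := 6) (q := 2) (by norm_num) (by norm_num) (Lp.memLp u)
      (fun n => (hψ n).memLp 6) ((Lp.memLp y).eval_piLp i)
      (fun n => ((hψ n).partialDeriv i).memLp 2)
      (fun n => HasWeakPartial.of_contDiff ((hψ n).1.of_le (by simp)) i) hu' ?_
    refine tendsto_of_tendsto_of_tendsto_of_le_of_le tendsto_const_nhds hg'
      (fun n => zero_le) fun n => ?_
    refine eLpNorm_mono fun x => ?_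
    exact PiLp.norm_apply_le (grad (ψ n) x - y x) i
  · have := ENNReal.Tendsto.pow (n := 2) hg'
    simpa [eLpNorm_two_sq] using this
  · have h1 := S.sub_starProjection_mem_orthogonal hF.toLp
    have h2 : (hφ.memLp_grad 2).toLp ∈ S :=
      gradSubmodule.le_topologicalClosure ⟨φ, hφ, rfl⟩
    have h3 := (Submodule.mem_orthogonal' _ _).1 h1 _ h2
    rw [L2.inner_def] at h3
    rw [← h3]
    refine integral_congr_ae ?_
    filter_upwards [Lp.coeFn_sub hF.toLp y, hF.coeFn_toLp, (hφ.memLp_grad 2).coeFn_toLp]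
      with x h4 h5 h6
    rw [h4, h6, Pi.sub_apply, h5]

/-! ### The Coulomb potential of a divergence free field -/

theorem enorm_sq_eq_sum {n : ℕ} (v : EuclideanSpace ℝ (Fin n)) :
    ‖v‖ₑ ^ 2 = ∑ i, ‖v i‖ₑ ^ 2 := by
  have h := EuclideanSpace.norm_sq_eq v
  rw [← ofReal_norm, ← ENNReal.ofReal_pow (norm_nonneg _), h,
    ENNReal.ofReal_sum_of_nonneg fun _ _ => by positivity]
  refine Finset.sum_congr rfl fun i _ => ?_
  rw [ENNReal.ofReal_pow (norm_nonneg _), ofReal_norm]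

theorem memHcheck_of_tendsto {u : Fin 3 → R3 → ℝ} {g : Fin 3 → R3 → R3} {ψ : Fin 3 → ℕ → R3 → ℝ}
    (hg : ∀ j, AEStronglyMeasurable (g j) volume)
    (hug : ∀ j i, HasWeakPartial i (u j) fun x => g j x i)
    (hψ : ∀ j n, IsTestFunction Set.univ (ψ j n))
    (hlim : ∀ j, Tendsto (fun n => ∫⁻ x, ‖grad (ψ j n) x - g j x‖ₑ ^ 2) atTop (𝓝 0)) :
    MemHcheck fun x => WithLp.toLp 2 fun j => u j x := by
  refine ⟨fun i j => ⟨_, hug j i⟩, fun n x => WithLp.toLp 2 fun j => ψ j n x, fun n => ⟨?_, ?_⟩, ?_⟩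
  · exact contDiff_euclidean.2 fun j => (hψ j n).1
  · have hK : IsCompact (⋃ j, tsupport (ψ j n)) := isCompact_iUnion fun j => (hψ j n).2.1
    refine HasCompactSupport.intro hK fun x hx => ?_
    ext j
    have h : ψ j n x = 0 := by_contra fun h => hx (Set.mem_iUnion.2 ⟨j, subset_tsupport _ h⟩)
    exact h
  · have hae : ∀ᵐ x ∂(volume : Measure R3), ∀ i j,
        weakJac (fun x => WithLp.toLp 2 fun j => u j x) i j x = g j x i := by
      rw [ae_all_iff]; intro i
      rw [ae_all_iff]; intro j
      exact (hug j i).weakPartial_ae_eq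
    have heq : ∀ n, ∫⁻ x, ∑ i, ∑ j, ‖partialDeriv i (fun y => ψ j n y) x -
        weakJac (fun x => WithLp.toLp 2 fun j => u j x) i j x‖ₑ ^ 2 =
        ∑ j, ∫⁻ x, ‖grad (ψ j n) x - g j x‖ₑ ^ 2 := by
      intro n
      rw [← lintegral_finsetSum']
      · refine lintegral_congr_ae ?_
        filter_upwards [hae] with x hx
        rw [Finset.sum_comm]
        simp only [hx, enorm_sq_eq_sum]
        rfl
      · intro j _
        refine AEMeasurable.pow_const (AEStronglyMeasurable.enorm ?_) 2
        exact ((hψ j n).memLp_grad 2).1.sub (hg j)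
    simp only [heq]
    simpa using tendsto_finsetSum Finset.univ fun j _ => hlim j

/-- Weak form of `Δ ∂ᵢu = ∂ᵢ div F`: orthogonality tested with `∂ᵢφ` says `Δu = div F`, and symmetry
of the derivatives of `φ` shifts `∂ᵢ` from one factor to the other. -/
theorem integral_weakPartial_mul_laplacian {u : R3 → ℝ} {F g : R3 → R3} (hF : MemLp F 2 volume)
    (hg : MemLp g 2 volume) (hug : ∀ i, HasWeakPartial i u fun x => g x i)
    (horth : ∀ φ, IsTestFunction Set.univ φ → ∫ x, inner ℝ (F x - g x) (grad φ x) = 0)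
    {φ : R3 → ℝ} (hφ : IsTestFunction Set.univ φ) (i : Fin 3) :
    ∫ x, g x i * laplacian φ x = ∑ k, ∫ x, F x k * partialDeriv k (partialDeriv i φ) x := by
  have hloc : ∀ {H : R3 → R3}, MemLp H 2 volume → ∀ k, LocallyIntegrable (fun x => H x k) volume :=
    fun hH k => (hH.eval_piLp k).locallyIntegrable (by norm_num)
  have h1 : ∀ k, ∫ x, g x i * partialDeriv k (partialDeriv k φ) x =
      ∫ x, g x k * partialDeriv k (partialDeriv i φ) x := by
    intro k
    have e1 := (hug i).2.2 _ ((hφ.partialDeriv k).partialDeriv k)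
    have e2 := (hug k).2.2 _ ((hφ.partialDeriv i).partialDeriv k)
    have e3 : partialDeriv i (partialDeriv k (partialDeriv k φ)) =
        partialDeriv k (partialDeriv k (partialDeriv i φ)) := by
      rw [partialDeriv_comm (contDiff_partialDeriv hφ.1) i k, partialDeriv_comm hφ.1 i k]
    rw [e3] at e1
    linarith
  rw [integral_mul_laplacian_eq_sum (hloc hg i) hφ, Finset.sum_congr rfl fun k _ => h1 k,
    ← sub_eq_zero, ← Finset.sum_sub_distrib, ← neg_eq_zero, ← Finset.sum_neg_distrib,
    ← horth _ (hφ.partialDeriv i)]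
  simp only [PiLp.inner_apply, grad_apply, RCLike.inner_apply, conj_trivial, PiLp.sub_apply]
  rw [integral_finsetSum]
  · refine Finset.sum_congr rfl fun k _ => ?_
    rw [neg_sub, ← integral_sub (((hφ.partialDeriv i).partialDeriv k).integrable_mul (hloc hF k))
      (((hφ.partialDeriv i).partialDeriv k).integrable_mul (hloc hg k))]
    congr 1; funext x; ring
  · intro k _
    simpa [mul_comm] using
      ((hφ.partialDeriv i).partialDeriv k).integrable_mul ((hloc hF k).sub (hloc hg k))

/-- A divergence free square integrable field is the curl of a divergence free field in `L⁶` with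
square integrable gradient. -/
theorem exists_coulomb_potential {B : R3 → R3} (hB : MemLp B 2 volume)
    (hdiv : ∀ φ, IsTestFunction Set.univ φ → ∫ x, inner ℝ (B x) (grad φ x) = 0) :
    ∃ (C : R3 → R3) (G : Fin 3 → R3 → R3), MemLp C 6 volume ∧ (∀ j, MemLp (G j) 2 volume) ∧
      (∀ i j, HasWeakPartial i (fun x => C x j) fun x => G j x i) ∧ MemHcheck C ∧
      (∀ᵐ x, ∑ i, G i x i = 0) ∧
      (∀ᵐ x, !₂[G 2 x 1 - G 1 x 2, G 0 x 2 - G 2 x 0, G 1 x 0 - G 0 x 1] = B x) := by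
  have hBi : ∀ i, MemLp (fun x => B x i) 2 volume := fun i => hB.eval_piLp i
  -- Chosen so that `div (F j) = -(curl B)ⱼ`; this encodes `Δuⱼ = -(curl B)ⱼ` without
  -- differentiating `B`.
  let F : Fin 3 → R3 → R3 :=
    ![fun x => !₂[0, -B x 2, B x 1], fun x => !₂[B x 2, 0, -B x 0], fun x => !₂[-B x 1, B x 0, 0]]
  have hz : MemLp (fun _ : R3 => (0 : ℝ)) 2 volume := MemLp.zero
  have hF : ∀ j, MemLp (F j) 2 volume := by
    intro j
    refine MemLp.of_eval_piLp fun k => ?_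
    have h0 := hBi 0; have h1 := hBi 1; have h2 := hBi 2
    have h0' := h0.neg; have h1' := h1.neg; have h2' := h2.neg
    fin_cases j <;> fin_cases k <;> assumption
  choose u g ψ hu hg hug hψ hlim horth using fun j => exists_gradient_part (hF j)
  have hloc : ∀ {f : R3 → ℝ}, MemLp f 2 volume → LocallyIntegrable f volume :=
    fun hf => hf.locallyIntegrable (by norm_num)
  have hgi : ∀ j i, MemLp (fun x => g j x i) 2 volume := fun j i => (hg j).eval_piLp i
  have key := fun {φ} (hφ : IsTestFunction Set.univ φ) j i =>
    integral_weakPartial_mul_laplacian (hF j) (hg j) (hug j) (horth j) hφ i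
  have hintg : ∀ {φ}, IsTestFunction Set.univ φ → ∀ {f : R3 → ℝ}, MemLp f 2 volume →
      Integrable (fun x => f x * laplacian φ x) volume := fun hφ f hf => by
    simpa [mul_comm] using (hloc hf).integrable_smul_left_of_hasCompactSupport
      (contDiff_laplacian hφ.1).continuous (hasCompactSupport_laplacian hφ)
  have hdiv' : ∀ {φ}, IsTestFunction Set.univ φ → ∀ i,
      ∑ k, ∫ x, B x k * partialDeriv k (partialDeriv i φ) x = 0 := by
    intro φ hφ i
    rw [← hdiv _ (hφ.partialDeriv i), ← integral_finsetSum]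
    · simp [PiLp.inner_apply, mul_comm]
    · exact fun k _ => ((hφ.partialDeriv i).partialDeriv k).integrable_mul (hloc (hBi k))
  -- The difference lies in `L²`, so Liouville's theorem applies. The hypothesis is then checked
  -- from `-curl curl B = ΔB - ∇ div B` with `div B = 0`.
  have hcurl : ∀ a b c : Fin 3, (∀ φ, IsTestFunction Set.univ φ →
      ∫ x, g a x b * laplacian φ x - g b x a * laplacian φ x = ∫ x, B x c * laplacian φ x) →
      ∀ᵐ x, g a x b - g b x a = B x c := by
    intro a b c h
    have h0 := ae_eq_zero_of_integral_mul_laplacian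
      (f := fun x => g a x b - g b x a - B x c) (((hgi a b).sub (hgi b a)).sub (hBi c))
      fun φ hφ => by
        simp only [sub_mul]
        have h3 : Integrable (fun x => g a x b * laplacian φ x - g b x a * laplacian φ x) volume :=
          (hintg hφ (hgi a b)).sub (hintg hφ (hgi b a))
        rw [integral_sub h3 (hintg hφ (hBi c)), h φ hφ, sub_self]
    filter_upwards [h0] with x hx
    exact sub_eq_zero.1 hx
  have hcomm : ∀ {φ}, IsTestFunction Set.univ φ → ∀ b i k : Fin 3,
      ∫ x, B x b * partialDeriv i (partialDeriv k φ) x =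
        ∫ x, B x b * partialDeriv k (partialDeriv i φ) x :=
    fun hφ b i k => by rw [partialDeriv_comm hφ.1 i k]
  refine ⟨fun x => WithLp.toLp 2 fun j => u j x, g, MemLp.of_eval_piLp hu, hg,
    fun i j => hug j i, memHcheck_of_tendsto (fun j => (hg j).1) hug hψ hlim, ?_, ?_⟩
  -- The divergence of the potential is harmonic because `div curl B = 0`: the mixed second
  -- derivatives cancel in pairs.
  · refine ae_eq_zero_of_integral_mul_laplacian (f := fun x => ∑ i, g i x i)
      (memLp_finsetSum _ fun i _ => hgi i i) fun φ hφ => ?_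
    simp only [Finset.sum_mul]
    rw [integral_finsetSum _ fun i _ => hintg hφ (hgi i i)]
    simp only [key hφ, Fin.sum_univ_three, F, Matrix.cons_val_zero, Matrix.cons_val_one,
      Matrix.cons_val, neg_mul, integral_neg, zero_mul, integral_zero]
    rw [hcomm hφ 2 1 0, hcomm hφ 1 2 0, hcomm hφ 0 2 1]
    ring
  · have h0 : ∀ᵐ x, g 2 x 1 - g 1 x 2 = B x 0 := hcurl 2 1 0 fun φ hφ => by
      rw [integral_sub (hintg hφ (hgi 2 1)) (hintg hφ (hgi 1 2)),
        integral_mul_laplacian_eq_sum (hloc (hBi 0)) hφ]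
      have h1 := hdiv' hφ 0
      simp only [key hφ, Fin.sum_univ_three, F, Matrix.cons_val_zero, Matrix.cons_val_one,
        Matrix.cons_val, neg_mul, integral_neg, zero_mul, integral_zero] at h1 ⊢
      have := hcomm hφ 1 0 1
      have := hcomm hφ 2 0 2
      linarith
    have h1 : ∀ᵐ x, g 0 x 2 - g 2 x 0 = B x 1 := hcurl 0 2 1 fun φ hφ => by
      rw [integral_sub (hintg hφ (hgi 0 2)) (hintg hφ (hgi 2 0)),
        integral_mul_laplacian_eq_sum (hloc (hBi 1)) hφ]
      have h1 := hdiv' hφ 1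
      simp only [key hφ, Fin.sum_univ_three, F, Matrix.cons_val_zero, Matrix.cons_val_one,
        Matrix.cons_val, neg_mul, integral_neg, zero_mul, integral_zero] at h1 ⊢
      have := hcomm hφ 0 0 1
      have := hcomm hφ 2 1 2
      linarith
    have h2 : ∀ᵐ x, g 1 x 0 - g 0 x 1 = B x 2 := hcurl 1 0 2 fun φ hφ => by
      rw [integral_sub (hintg hφ (hgi 1 0)) (hintg hφ (hgi 0 1)),
        integral_mul_laplacian_eq_sum (hloc (hBi 2)) hφ]
      have h1 := hdiv' hφ 2
      simp only [key hφ, Fin.sum_univ_three, F, Matrix.cons_val_zero, Matrix.cons_val_one,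
        Matrix.cons_val, neg_mul, integral_neg, zero_mul, integral_zero] at h1 ⊢
      have := hcomm hφ 0 0 2
      have := hcomm hφ 1 1 2
      linarith
    filter_upwards [h0, h1, h2] with x e0 e1 e2
    ext k
    fin_cases k
    · exact e0
    · exact e1
    · exact e2

/-! ### Signed measures and weak compactness -/

section Measure

variable {X : Type*} [MeasurableSpace X]

/-- The Jordan decomposition is minimal. Thus `p` and `q` need not be mutually singular in the
reduced problem, a property that weak limits would destroy. -/
theorem totalVariation_sub_le (p q : Measure X) [IsFiniteMeasure p] [IsFiniteMeasure q] :
    (p.toSignedMeasure - q.toSignedMeasure).totalVariation Set.univ ≤ p Set.univ + q Set.univ := by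
  rw [SignedMeasure.totalVariation, Measure.add_apply,
    Measure.toJordanDecomposition_toSignedMeasure_sub]
  exact add_le_add (Measure.sub_le _) (Measure.sub_le _)

theorem integralSigned_sub (p q : Measure X) [IsFiniteMeasure p] [IsFiniteMeasure q] {f : X → ℝ}
    (hp : Integrable f p) (hq : Integrable f q) :
    integralSigned (p.toSignedMeasure - q.toSignedMeasure) f = ∫ x, f x ∂p - ∫ x, f x ∂q := by
  set s := p.toSignedMeasure - q.toSignedMeasure with hs
  set j := s.toJordanDecomposition with hj
  -- Cross-adding turns equality of two differences into an equality of positive measures, against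
  -- which `f` can be integrated.
  have h1 : j.posPart + q = p + j.negPart := by
    rw [← Measure.toSignedMeasure_eq_toSignedMeasure_iff, Measure.toSignedMeasure_add,
      Measure.toSignedMeasure_add]
    have h2 : j.posPart.toSignedMeasure - j.negPart.toSignedMeasure = s :=
      s.toSignedMeasure_toJordanDecomposition
    rw [hs, sub_eq_sub_iff_add_eq_add] at h2
    exact h2
  have hjp : Integrable f j.posPart := hp.mono_measure (by
    rw [hj, hs, Measure.toJordanDecomposition_toSignedMeasure_sub]; exact Measure.sub_le)
  have hjn : Integrable f j.negPart := hq.mono_measure (by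
    rw [hj, hs, Measure.toJordanDecomposition_toSignedMeasure_sub]; exact Measure.sub_le)
  have h3 := congrArg (fun μ => ∫ x, f x ∂μ) h1
  simp only [integral_add_measure hjp hq, integral_add_measure hp hjn] at h3
  rw [integralSigned]
  linarith

end Measure

theorem exists_tendsto_ultrafilter {U : Ultrafilter ℕ} {a : ℕ → ℝ} {M : ℝ} (h : ∀ n, |a n| ≤ M) :
    ∃ l, Tendsto a U (𝓝 l) := by
  obtain ⟨l, -, hl⟩ := (isCompact_Icc (a := -M) (b := M)).ultrafilter_le_nhds (U.map a)
    (le_principal_iff.2 (mem_map.2 (univ_mem' fun n => abs_le.1 (h n))))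
  exact ⟨l, hl⟩

open scoped CompactlySupported in
/-- Vague compactness of bounded sequences of measures, along an ultrafilter. -/
theorem exists_measure_tendsto_ultrafilter {X : Type*} [TopologicalSpace X] [T2Space X]
    [LocallyCompactSpace X] [MeasurableSpace X] [BorelSpace X] {U : Ultrafilter ℕ}
    {p : ℕ → Measure X} {M : ℝ≥0∞} (hM : M < ⊤) (hp : ∀ n, p n Set.univ ≤ M) :
    ∃ ν : Measure X, (∀ f : X → ℝ, Continuous f → HasCompactSupport f →
      Tendsto (fun n => ∫ x, f x ∂(p n)) U (𝓝 (∫ x, f x ∂ν))) ∧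
      ∀ a, Tendsto (fun n => p n Set.univ) U (𝓝 a) → ν Set.univ ≤ a := by
  have hfin : ∀ n, IsFiniteMeasure (p n) := fun n => ⟨(hp n).trans_lt hM⟩
  have hint : ∀ (f : C_c(X, ℝ)) n, Integrable f (p n) := fun f n =>
    f.continuous.integrable_of_hasCompactSupport f.hasCompactSupport
  -- Along an ultrafilter every bounded real sequence converges, so all test integrals converge at
  -- once and no separability or diagonal argument is needed. The limit functional is positive and
  -- Riesz–Markov represents it.
  have hex : ∀ f : C_c(X, ℝ), ∃ l, Tendsto (fun n => ∫ x, f x ∂(p n)) U (𝓝 l) := by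
    intro f
    obtain ⟨K, hK⟩ := f.continuous.bounded_above_of_compact_support f.hasCompactSupport
    refine exists_tendsto_ultrafilter (M := max K 0 * M.toReal) fun n => ?_
    refine (norm_integral_le_of_norm_le_const
      (Eventually.of_forall fun x => (hK x).trans (le_max_left K 0))).trans ?_
    exact mul_le_mul_of_nonneg_left (ENNReal.toReal_mono hM.ne (hp n)) (le_max_right _ _)
  choose l hl using hex
  let Λ : C_c(X, ℝ) →ₚ[ℝ] ℝ := PositiveLinearMap.mk₀
    { toFun := l
      map_add' := fun f g => tendsto_nhds_unique (hl (f + g)) (by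
        simpa [integral_add (hint f _) (hint g _)] using (hl f).add (hl g))
      map_smul' := fun c f => tendsto_nhds_unique (hl (c • f)) (by
        simpa [integral_const_mul] using (hl f).const_mul c) }
    fun f hf => ge_of_tendsto' (hl f) fun n => integral_nonneg fun x => hf x
  have hΛ : ∀ f, Λ f = l f := fun f => rfl
  refine ⟨RealRMK.rieszMeasure Λ, fun f hf hf' => ?_, fun a ha => ?_⟩
  · have h1 := RealRMK.integral_rieszMeasure Λ ⟨⟨f, hf⟩, hf'⟩
    have h2 := hl ⟨⟨f, hf⟩, hf'⟩
    rw [← hΛ, ← h1] at h2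
    exact h2
  -- Mass can only be lost in the limit: by inner regularity it suffices to bound compact sets, each
  -- dominated by a cutoff with values in `[0, 1]`.
  · rw [isOpen_univ.measure_eq_iSup_isCompact]
    refine iSup_le fun K => iSup_le fun _ => iSup_le fun hK => ?_
    obtain ⟨f, hf1, -, hf3, hf4⟩ := exists_continuous_one_zero_of_isCompact hK isClosed_empty
      (Set.disjoint_empty K)
    refine (RealRMK.rieszMeasure_le_of_eq_one Λ (f := ⟨f, hf3⟩) (fun x => (hf4 x).1) hK
      fun x hx => hf1 hx).trans ?_
    have haM : a ≤ M := le_of_tendsto' ha hp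
    have ha' : a ≠ ⊤ := (haM.trans_lt hM).ne
    rw [hΛ]
    refine ENNReal.ofReal_le_of_le_toReal ?_
    refine le_of_tendsto_of_tendsto' (hl _) ((ENNReal.tendsto_toReal ha').comp ha) fun n => ?_
    refine (integral_mono (hint ⟨f, hf3⟩ n) (integrable_const 1) fun x => (hf4 x).2).trans ?_
    simp [Measure.real]

/-- Weak compactness of bounded sequences in a Hilbert space, along an ultrafilter. -/
theorem exists_weak_limit {H : Type*} [NormedAddCommGroup H] [InnerProductSpace ℝ H]
    [CompleteSpace H] {U : Ultrafilter ℕ} {x : ℕ → H} {M : ℝ} (hx : ∀ n, ‖x n‖ ≤ M) :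
    ∃ y : H, (∀ z, Tendsto (fun n => inner ℝ (x n) z) U (𝓝 (inner ℝ y z))) ∧
      ∀ r, Tendsto (fun n => ‖x n‖ ^ 2) U (𝓝 r) → ‖y‖ ^ 2 ≤ r := by
  have hb : ∀ z n, |inner ℝ (x n) z| ≤ M * ‖z‖ := fun z n =>
    (abs_real_inner_le_norm _ _).trans (mul_le_mul_of_nonneg_right (hx n) (norm_nonneg _))
  choose l hl using fun z => exists_tendsto_ultrafilter (U := U) (hb z)
  let Λ : H →ₗ[ℝ] ℝ :=
    { toFun := l
      map_add' := fun f g => tendsto_nhds_unique (hl (f + g)) (by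
        simpa [inner_add_right] using (hl f).add (hl g))
      map_smul' := fun c f => tendsto_nhds_unique (hl (c • f)) (by
        simpa [inner_smul_right] using (hl f).const_mul c) }
  let Λ' : H →L[ℝ] ℝ := Λ.mkContinuous M fun z =>
    le_of_tendsto' (hl z).abs fun n => hb z n
  refine ⟨(InnerProductSpace.toDual ℝ H).symm Λ', fun z => ?_, fun r hr => ?_⟩
  · rw [InnerProductSpace.toDual_symm_apply]
    exact hl z
  · set y := (InnerProductSpace.toDual ℝ H).symm Λ'
    have h1 : Tendsto (fun n => inner ℝ (x n) y) U (𝓝 (‖y‖ ^ 2)) := by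
      rw [← real_inner_self_eq_norm_sq, InnerProductSpace.toDual_symm_apply]
      exact hl y
    -- Lower semicontinuity of the squared norm, from `⟨xₙ, y⟩ ≤ (‖xₙ‖² + ‖y‖²) / 2`.
    have h2 : ‖y‖ ^ 2 ≤ (r + ‖y‖ ^ 2) / 2 :=
      le_of_tendsto_of_tendsto' h1 ((hr.add_const _).div_const 2) fun n => by
        have := real_inner_le_norm (x n) y
        nlinarith [sq_nonneg (‖x n‖ - ‖y‖)]
    linarith

theorem exists_weak_limit_L2 {α : Type*} [MeasurableSpace α] {μ : Measure α} {k : ℕ}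
    {U : Ultrafilter ℕ} {f : ℕ → α → EuclideanSpace ℝ (Fin k)} (hf : ∀ n, MemLp (f n) 2 μ)
    {M : ℝ≥0∞} (hM : M < ⊤) (hfM : ∀ n, ∫⁻ x, ‖f n x‖ₑ ^ 2 ∂μ ≤ M) :
    ∃ g, MemLp g 2 μ ∧
      (∀ h, MemLp h 2 μ →
        Tendsto (fun n => ∫ x, inner ℝ (f n x) (h x) ∂μ) U (𝓝 (∫ x, inner ℝ (g x) (h x) ∂μ))) ∧
      ∀ a, Tendsto (fun n => ∫⁻ x, ‖f n x‖ₑ ^ 2 ∂μ) U (𝓝 a) → ∫⁻ x, ‖g x‖ₑ ^ 2 ∂μ ≤ a := by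
  have hsq : ∀ n, ‖(hf n).toLp‖ ^ 2 = (∫⁻ x, ‖f n x‖ₑ ^ 2 ∂μ).toReal := fun n => by
    rw [Lp.norm_toLp, ← ENNReal.toReal_pow, eLpNorm_two_sq]
  obtain ⟨y, hy, hy'⟩ := exists_weak_limit (U := U) (x := fun n => (hf n).toLp)
    -- The bound `t ≤ t² + 1` avoids a square root.
    (M := M.toReal + 1) fun n => by
      have h1 : ‖(hf n).toLp‖ ^ 2 ≤ M.toReal := by
        rw [hsq]; exact ENNReal.toReal_mono hM.ne (hfM n)
      nlinarith [sq_nonneg (‖(hf n).toLp‖ - 1), ENNReal.toReal_nonneg (a := M)]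
  refine ⟨y, Lp.memLp y, fun h hh => ?_, fun a ha => ?_⟩
  · have h1 := hy hh.toLp
    simp only [L2.inner_def] at h1
    have e1 : ∀ n, ∫ x, inner ℝ (((hf n).toLp (f n) : α → EuclideanSpace ℝ (Fin k)) x)
        ((hh.toLp h : α → EuclideanSpace ℝ (Fin k)) x) ∂μ = ∫ x, inner ℝ (f n x) (h x) ∂μ :=
      fun n => integral_congr_ae (by
        filter_upwards [(hf n).coeFn_toLp, hh.coeFn_toLp] with x h2 h3
        rw [h2, h3])
    have e2 : ∫ x, inner ℝ (y x) ((hh.toLp h : α → EuclideanSpace ℝ (Fin k)) x) ∂μ = ∫ x, inner ℝ (y x) (h x) ∂μ :=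
      integral_congr_ae (by
        filter_upwards [hh.coeFn_toLp] with x h3
        rw [h3])
    simpa only [e1, e2] using h1
  · have ha' : a ≠ ⊤ := ((le_of_tendsto' ha hfM).trans_lt hM).ne
    have h1 := hy' a.toReal (by
      simp only [hsq]
      exact (ENNReal.tendsto_toReal ha').comp ha)
    rw [← eLpNorm_two_sq, ← ENNReal.toReal_le_toReal (ENNReal.pow_ne_top (Lp.memLp y).2.ne) ha',
      ENNReal.toReal_pow]
    exact h1

/-! ### The reduced problem -/

/-- The planar rotated gradient `(∂₂ φ, -∂₁ φ)`. -/
noncomputable def rotGrad (φ : R3 → ℝ) (x : R3) : R2 := !₂[partialDeriv 1 φ x, -partialDeriv 0 φ x]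

theorem inner_rotGrad (w : R2) (φ : R3 → ℝ) (x : R3) :
    inner ℝ w (rotGrad φ x) = w 0 * partialDeriv 1 φ x - w 1 * partialDeriv 0 φ x := by
  simp [PiLp.inner_apply, rotGrad, Fin.sum_univ_two]; ring

theorem inner_smul_e3 (y : R3) (c : ℝ) : inner ℝ y (c • e3) = y 2 * c := by
  simp [PiLp.inner_apply, e3, Fin.sum_univ_three]; ring

theorem memLp_rotGrad {U : Set R3} {φ : R3 → ℝ} (hφ : IsTestFunction U φ) (p : ℝ≥0∞) :
    MemLp (rotGrad φ) p volume := by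
  refine MemLp.of_eval_piLp fun i => ?_
  fin_cases i
  · exact (hφ.partialDeriv 1).memLp p
  · exact ((hφ.partialDeriv 0).memLp p).neg

theorem MemLp.smul_e3 {φ : R3 → ℝ} {p : ℝ≥0∞} (hφ : MemLp φ p volume) :
    MemLp (fun x => φ x • e3) p volume := by
  refine MemLp.of_eval_piLp fun i => ?_
  fin_cases i
  · simp [e3]
  · simp [e3]
  · simpa [e3] using hφ

theorem integrable_inner_of_memLp {α E : Type*} [MeasurableSpace α] [NormedAddCommGroup E]
    [InnerProductSpace ℝ E] {μ : Measure α} {f g : α → E} (hf : MemLp f 2 μ) (hg : MemLp g 2 μ) :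
    Integrable (fun x => inner ℝ (f x) (g x)) μ := by
  refine (L2.integrable_inner (𝕜 := ℝ) (hf.toLp f) (hg.toLp g)).congr ?_
  filter_upwards [hf.coeFn_toLp, hg.coeFn_toLp] with x h1 h2
  rw [h1, h2]

/-- The data of the reduced problem: `w` stands for `v - Â`, `B` for `∇ × A - h₀ e₃` and `p - q`
for `curl v`. -/
structure Admissible (D : Set R3) (h₀ : ℝ) (w : R3 → R2) (B : R3 → R3) (p q : Measure D) :
    Prop where
  memLp_fst : MemLp w 2 (volume.restrict D)
  memLp_snd : MemLp B 2 volume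
  div_free : ∀ φ, IsTestFunction Set.univ φ → ∫ x, inner ℝ (B x) (grad φ x) = 0
  finite_pos : IsFiniteMeasure p
  finite_neg : IsFiniteMeasure q
  curl_eq : ∀ φ, IsTestFunction D φ → ∫ x : D, φ x ∂p - ∫ x : D, φ x ∂q =
    (∫ x in D, inner ℝ (w x) (rotGrad φ x)) + (∫ x, inner ℝ (B x) (φ x • e3)) + ∫ x, h₀ * φ x

/-- The reduced energy (without the factor `1 / 2`). -/
noncomputable def reducedEnergy (D : Set R3) (w : R3 → R2) (B : R3 → R3) (p q : Measure D) :
    ℝ≥0∞ :=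
  (∫⁻ x in D, ‖w x‖ₑ ^ 2) + (p Set.univ + q Set.univ) + ∫⁻ x, ‖B x‖ₑ ^ 2

theorem cylinder_isOpen {Ω : Set R2} (hΩ : IsOpen Ω) (L : ℝ) : IsOpen (cylinder Ω L) := by
  have hc : Continuous hat := by
    refine (PiLp.continuous_toLp 2 _).comp (continuous_pi fun i => ?_)
    fin_cases i
    · exact PiLp.continuous_apply 2 _ 0
    · exact PiLp.continuous_apply 2 _ 1
  have hc2 : Continuous fun x : R3 => x 2 := PiLp.continuous_apply 2 _ 2
  exact (hΩ.preimage hc).inter ((isOpen_lt continuous_const hc2).inter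
    (isOpen_lt hc2 continuous_const))

theorem exists_cylinder_subset_closedBall {Ω : Set R2} (hΩ : Bornology.IsBounded Ω) (L : ℝ) :
    ∃ R, cylinder Ω L ⊆ Metric.closedBall 0 R := by
  obtain ⟨R, hR⟩ := hΩ.subset_closedBall 0
  refine ⟨R + L, fun x ⟨h1, h2, h3⟩ => ?_⟩
  have h4 := mem_closedBall_zero_iff.1 (hR h1)
  rw [mem_closedBall_zero_iff]
  have h5 : ‖x‖ ^ 2 = ‖hat x‖ ^ 2 + x 2 ^ 2 := by
    simp [EuclideanSpace.norm_sq_eq, Fin.sum_univ_three, hat, Fin.sum_univ_two]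
  have h6 := norm_nonneg (hat x)
  refine abs_le_of_sq_le_sq' ?_ (by linarith) |>.2
  rw [h5]
  nlinarith

theorem memLp_hat {A : R3 → R3} (hA : MemH1loc A) {D : Set R3} {R : ℝ}
    (hD : D ⊆ Metric.closedBall 0 R) : MemLp (fun x => hat (A x)) 2 (volume.restrict D) := by
  have h : ∀ j, MemLp (fun x => A x j) 2 (volume.restrict D) := fun j =>
    ((hA j).1 _ (isCompact_closedBall 0 R)).mono_measure (Measure.restrict_mono hD le_rfl)
  refine MemLp.of_eval_piLp fun i => ?_
  fin_cases i
  · exact h 0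
  · exact h 1

theorem MemH1loc.hasWeakPartial {A : R3 → R3} (hA : MemH1loc A) (i j : Fin 3) :
    HasWeakPartial i (fun x => A x j) (weakJac A i j) :=
  let ⟨_, _, hg⟩ := (hA j).2 i
  hg.weakPartial

/-- The planar curl of `Â` is the third component of `∇ × A`. Since `φ` is supported in `D`, the
weak derivatives on the whole space apply. -/
theorem setIntegral_hat_rotGrad {A : R3 → R3} (hA : MemH1loc A) {D : Set R3} {φ : R3 → ℝ}
    (hφ : IsTestFunction D φ) :
    ∫ x in D, inner ℝ (hat (A x)) (rotGrad φ x) = ∫ x, curl A x 2 * φ x := by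
  have hJ := hA.hasWeakPartial
  have h0 : ∀ i x, x ∉ D → partialDeriv i φ x = 0 := fun i x hx =>
    image_eq_zero_of_notMem_tsupport fun h => hx ((hφ.partialDeriv i).2.2 h)
  rw [setIntegral_eq_integral_of_forall_compl_eq_zero fun x hx => by
    rw [inner_rotGrad, h0 _ x hx, h0 _ x hx]; simp]
  have h1 := (hJ 1 0).2.2 φ hφ.univ
  have h2 := (hJ 0 1).2.2 φ hφ.univ
  simp only [inner_rotGrad]
  rw [integral_sub]
  · change (∫ x, A x 0 * partialDeriv 1 φ x) - (∫ x, A x 1 * partialDeriv 0 φ x) =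
      ∫ x, (weakJac A 0 1 x - weakJac A 1 0 x) * φ x
    simp only [sub_mul]
    rw [integral_sub (hφ.integrable_mul (hJ 0 1).2.1) (hφ.integrable_mul (hJ 1 0).2.1)]
    linarith
  · exact (hφ.partialDeriv 1).integrable_mul (hJ 1 0).1
  · exact (hφ.partialDeriv 0).integrable_mul (hJ 0 1).1

theorem integral_partialDeriv_eq_zero {φ : R3 → ℝ} (hφ : IsTestFunction Set.univ φ) (i : Fin 3) :
    ∫ x, partialDeriv i φ x = 0 := by
  have h := integral_mul_partialDeriv (g := fun _ => 1) contDiff_const hφ i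
  simpa [partialDeriv] using h

/-- `div curl = 0` by symmetry of second derivatives of `φ`, and the constant field `h₀ e₃` pairs to
zero with the gradient of a test function. -/
theorem integral_curl_inner_grad {A : R3 → R3} (hA : MemH1loc A) (h₀ : ℝ) {φ : R3 → ℝ}
    (hφ : IsTestFunction Set.univ φ) :
    ∫ x, inner ℝ (curl A x - h₀ • e3) (grad φ x) = 0 := by
  have hJ := hA.hasWeakPartial
  have hI : ∀ i j k, Integrable (fun x => weakJac A i j x * partialDeriv k φ x) volume :=
    fun i j k => (hφ.partialDeriv k).integrable_mul (hJ i j).2.1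
  have hpt : ∀ x, inner ℝ (curl A x - h₀ • e3) (grad φ x) =
      (weakJac A 1 2 x * partialDeriv 0 φ x - weakJac A 2 1 x * partialDeriv 0 φ x) +
      (weakJac A 2 0 x * partialDeriv 1 φ x - weakJac A 0 2 x * partialDeriv 1 φ x) +
      (weakJac A 0 1 x * partialDeriv 2 φ x - weakJac A 1 0 x * partialDeriv 2 φ x) -
      h₀ * partialDeriv 2 φ x := by
    intro x
    simp [PiLp.inner_apply, curl, e3, Fin.sum_univ_three]; ring
  have hsub : ∀ i j k l m, ∫ x, (weakJac A i j x * partialDeriv k φ x -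
      weakJac A l m x * partialDeriv k φ x) =
      (∫ x, weakJac A i j x * partialDeriv k φ x) - ∫ x, weakJac A l m x * partialDeriv k φ x :=
    fun i j k l m => integral_sub (hI i j k) (hI l m k)
  have hI' : ∀ i j k l m, Integrable (fun x => weakJac A i j x * partialDeriv k φ x -
      weakJac A l m x * partialDeriv k φ x) volume := fun i j k l m => (hI i j k).sub (hI l m k)
  have hS : Integrable (fun x =>
      (weakJac A 1 2 x * partialDeriv 0 φ x - weakJac A 2 1 x * partialDeriv 0 φ x) +
      (weakJac A 2 0 x * partialDeriv 1 φ x - weakJac A 0 2 x * partialDeriv 1 φ x)) volume :=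
    (hI' 1 2 0 2 1).add (hI' 2 0 1 0 2)
  have hS' : Integrable (fun x =>
      (weakJac A 1 2 x * partialDeriv 0 φ x - weakJac A 2 1 x * partialDeriv 0 φ x) +
      (weakJac A 2 0 x * partialDeriv 1 φ x - weakJac A 0 2 x * partialDeriv 1 φ x) +
      (weakJac A 0 1 x * partialDeriv 2 φ x - weakJac A 1 0 x * partialDeriv 2 φ x)) volume :=
    hS.add (hI' 0 1 2 1 0)
  simp only [hpt]
  rw [integral_sub hS' ((memLp_one_iff_integrable.1 ((hφ.partialDeriv 2).memLp 1)).const_mul h₀),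
    integral_add hS (hI' 0 1 2 1 0),
    integral_add (hI' 1 2 0 2 1) (hI' 2 0 1 0 2), hsub, hsub, hsub, integral_const_mul,
    integral_partialDeriv_eq_zero hφ]
  have e := fun i j k => (hJ i j).2.2 _ (hφ.partialDeriv k)
  have e1 := e 1 2 0; have e2 := e 2 1 0; have e3 := e 2 0 1
  have e4 := e 0 2 1; have e5 := e 0 1 2; have e6 := e 1 0 2
  rw [partialDeriv_comm hφ.1 1 0] at e1
  rw [partialDeriv_comm hφ.1 2 0] at e2
  rw [partialDeriv_comm hφ.1 2 1] at e3
  linarith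

theorem IsTestFunction.integrable_subtype {D : Set R3} {φ : R3 → ℝ} (hφ : IsTestFunction D φ)
    (p : Measure D) [IsFiniteMeasure p] : Integrable (fun x : D => φ x) p := by
  obtain ⟨K, hK⟩ := hφ.continuous.bounded_above_of_compact_support hφ.2.1
  exact Integrable.of_bound (hφ.continuous.comp continuous_subtype_val).aestronglyMeasurable K
    (Eventually.of_forall fun x => hK x)

theorem integral_inner_curl {A : R3 → R3} (hA : MemH1loc A) (h₀ : ℝ) {D : Set R3} {φ : R3 → ℝ}
    (hφ : IsTestFunction D φ) :
    (∫ x, inner ℝ (curl A x - h₀ • e3) (φ x • e3)) + ∫ x, h₀ * φ x = ∫ x, curl A x 2 * φ x := by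
  have h2 : Integrable (fun x => h₀ * φ x) volume :=
    (memLp_one_iff_integrable.1 (hφ.memLp 1)).const_mul h₀
  have h1 : Integrable (fun x => curl A x 2 * φ x) volume :=
    hφ.integrable_mul ((hA.hasWeakPartial 0 1).2.1.sub (hA.hasWeakPartial 1 0).2.1)
  rw [← integral_add _ h2]
  · refine integral_congr_ae (Eventually.of_forall fun x => ?_)
    change inner ℝ (curl A x - h₀ • e3) (φ x • e3) + h₀ * φ x = _
    rw [inner_smul_e3]; simp [e3]; ring
  · refine (h1.sub h2).congr (Eventually.of_forall fun x => ?_)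
    change _ = inner ℝ (curl A x - h₀ • e3) (φ x • e3)
    rw [inner_smul_e3]; simp [e3]; ring

/-! ### Passing between the full and the reduced problem -/

/-- Every competitor for the full problem yields an admissible datum of the reduced problem. -/
theorem admissible_of_mem {D : Set R3} {R : ℝ} (hD : D ⊆ Metric.closedBall 0 R) {h₀ : ℝ}
    {v : R3 → R2} {A : R3 → R3} (hv : MemLp v 2 (volume.restrict D)) (hA : A ∈ spaceE h₀)
    {μ : SignedMeasure D} (hμ : IsCurlMeasure D v μ) :
    Admissible D h₀ (fun x => v x - hat (A x)) (fun x => curl A x - h₀ • e3)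
      μ.toJordanDecomposition.posPart μ.toJordanDecomposition.negPart where
  memLp_fst := hv.sub (memLp_hat hA.1 hD)
  memLp_snd := hA.2
  div_free φ hφ := integral_curl_inner_grad hA.1 h₀ hφ
  finite_pos := inferInstance
  finite_neg := inferInstance
  curl_eq φ hφ := by
    have h1 := hμ φ hφ
    have hr := (memLp_rotGrad hφ 2).restrict D
    have h2 : ∫ x in D, inner ℝ (v x - hat (A x)) (rotGrad φ x) =
        (∫ x in D, inner ℝ (v x) (rotGrad φ x)) - ∫ x in D, inner ℝ (hat (A x)) (rotGrad φ x) := by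
      simp only [inner_sub_left]
      exact integral_sub (integrable_inner_of_memLp hv hr) (integrable_inner_of_memLp (memLp_hat hA.1 hD) hr)
    rw [h2, setIntegral_hat_rotGrad hA.1 hφ, add_assoc, integral_inner_curl hA.1 h₀ hφ]
    simp only [inner_rotGrad, sub_add_cancel]
    exact h1

theorem hasWeakPartial_aField (h₀ : ℝ) (i j : Fin 3) :
    HasWeakPartial i (fun x => (h₀ • aField x) j) fun _ =>
      h₀ * (!![0, 1 / 2, 0; -1 / 2, 0, 0; 0, 0, 0] : Matrix (Fin 3) (Fin 3) ℝ) i j := by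
  let l : Fin 3 → R3 →L[ℝ] ℝ := ![-(h₀ / 2) • EuclideanSpace.proj 1,
    (h₀ / 2) • EuclideanSpace.proj 0, 0]
  have h1 : (fun x => (h₀ • aField x) j) = l j := by
    funext x
    fin_cases j <;> simp [aField, l] <;> ring
  have h2 : (fun _ : R3 => h₀ * (!![0, 1 / 2, 0; -1 / 2, 0, 0; 0, 0, 0] :
      Matrix (Fin 3) (Fin 3) ℝ) i j) = partialDeriv i (l j) := by
    funext x
    rw [partialDeriv_clm]
    fin_cases i <;> fin_cases j <;> simp [l] <;> ring
  rw [h1, h2]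
  exact HasWeakPartial.of_contDiff (l j).contDiff i

theorem memL2loc_of_continuous {f : R3 → ℝ} (hf : Continuous f) : MemL2loc f := fun K hK => by
  have : IsFiniteMeasure ((volume : Measure R3).restrict K) :=
    ⟨by simpa using hK.measure_lt_top⟩
  obtain ⟨M, hM⟩ := hK.exists_bound_of_continuousOn hf.continuousOn
  exact MemLp.of_bound hf.aestronglyMeasurable M (ae_restrict_of_forall_mem hK.measurableSet hM)

theorem memL2loc_of_memLp {f : R3 → ℝ} {p : ℝ≥0∞} (hp : 2 ≤ p) (hf : MemLp f p volume) :
    MemL2loc f := fun K hK => by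
  have : IsFiniteMeasure ((volume : Measure R3).restrict K) :=
    ⟨by simpa using hK.measure_lt_top⟩
  exact (hf.restrict K).mono_exponent hp

theorem MemL2loc.add {f g : R3 → ℝ} (hf : MemL2loc f) (hg : MemL2loc g) :
    MemL2loc fun x => f x + g x := fun K hK => (hf K hK).add (hg K hK)

/-- Every admissible datum of the reduced problem yields a competitor for the full problem, in
Coulomb gauge, with at most the same energy. -/
theorem Admissible.exists_mem {D : Set R3} {R : ℝ} (hD : D ⊆ Metric.closedBall 0 R) {h₀ : ℝ}
    {w : R3 → R2} {B : R3 → R3} {p q : Measure D} (h : Admissible D h₀ w B p q) :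
    ∃ v ∈ spaceV D, ∃ A ∈ spaceK h₀,
      limitEnergy D h₀ (v, A) ≤ 2⁻¹ * reducedEnergy D w B p q := by
  have := h.finite_pos
  have := h.finite_neg
  obtain ⟨C, G, hC, hG, hCG, hCh, hdiv, hcurl⟩ := exists_coulomb_potential h.memLp_snd h.div_free
  set A : R3 → R3 := fun x => C x + h₀ • aField x
  -- The constant Jacobian `∂ᵢ aʲ`. Being antisymmetric it adds nothing to the divergence, and its
  -- curl is `e₃`.
  set N : Matrix (Fin 3) (Fin 3) ℝ := !![0, 1 / 2, 0; -1 / 2, 0, 0; 0, 0, 0]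
  have hAw : ∀ i j, HasWeakPartial i (fun x => A x j) fun x => G j x i + h₀ * N i j :=
    fun i j => (hCG i j).add (hasWeakPartial_aField h₀ i j)
  have hAE : MemH1loc A := fun j => by
    refine ⟨(memL2loc_of_memLp (by norm_num) (hC.eval_piLp j)).add (memL2loc_of_continuous ?_),
      fun i => ⟨_, (memL2loc_of_memLp le_rfl ((hG j).eval_piLp i)).add
        (memL2loc_of_continuous continuous_const), hAw i j⟩⟩
    fin_cases j <;> simp [aField] <;> fun_prop
  have hJ : ∀ᵐ x, ∀ i j, weakJac A i j x = G j x i + h₀ * N i j := by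
    rw [ae_all_iff]; intro i
    rw [ae_all_iff]; intro j
    exact (hAw i j).weakPartial_ae_eq
  have hcA : ∀ᵐ x, curl A x - h₀ • e3 = B x := by
    filter_upwards [hJ, hcurl] with x h1 h2
    rw [← h2]
    ext k
    fin_cases k
    · simp [curl, h1, e3, N]
    · simp [curl, h1, e3, N]
    · simp [curl, h1, e3, N]; ring
  have hAsub : (fun x => A x - h₀ • aField x) = C := by
    funext x; simp [A]
  have hAK : A ∈ spaceK h₀ := by
    refine ⟨⟨hAE, (memLp_congr_ae hcA).2 h.memLp_snd⟩, ?_, by rwa [hAsub], by rwa [hAsub]⟩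
    filter_upwards [hJ, hdiv] with x h1 h2
    simp only [divergence, h1, Finset.sum_add_distrib, h2]
    simp [N, Fin.sum_univ_three]
  have hint : ∀ φ : R3 → ℝ, ∫ x, inner ℝ (B x) (φ x • e3) =
      ∫ x, inner ℝ (curl A x - h₀ • e3) (φ x • e3) := fun φ =>
    integral_congr_ae (by filter_upwards [hcA] with x hx; rw [hx])
  have hμ : IsCurlMeasure D (fun x => w x + hat (A x)) (p.toSignedMeasure - q.toSignedMeasure) := by
    intro φ hφ
    have hr := (memLp_rotGrad hφ 2).restrict D
    rw [integralSigned_sub p q (hφ.integrable_subtype p) (hφ.integrable_subtype q), h.curl_eq φ hφ,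
      hint, add_assoc, integral_inner_curl hAE h₀ hφ, ← setIntegral_hat_rotGrad hAE hφ,
      ← integral_add (integrable_inner_of_memLp h.memLp_fst hr) (integrable_inner_of_memLp (memLp_hat hAE hD) hr)]
    refine integral_congr_ae (Eventually.of_forall fun x => ?_)
    simp only [← inner_rotGrad, inner_add_left]
  refine ⟨fun x => w x + hat (A x), ⟨h.memLp_fst.add (memLp_hat hAE hD), _, hμ⟩, A, hAK, ?_⟩
  unfold limitEnergy reducedEnergy
  refine mul_le_mul_right (add_le_add (add_le_add ?_ ?_) ?_) _
  · simp
  · unfold curlVariation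
    exact (iInf₂_le _ hμ).trans (totalVariation_sub_le p q)
  · refine le_of_eq (lintegral_congr_ae ?_)
    filter_upwards [hcA] with x hx
    simp only [hx]

/-! ### Existence of minimizers -/

theorem exists_admissible {D : Set R3} (hDm : MeasurableSet D) {R : ℝ}
    (hD : D ⊆ Metric.closedBall 0 R) {h₀ : ℝ} (hh₀ : 0 ≤ h₀) :
    ∃ w B p q, Admissible D h₀ w B p q := by
  have hfin : IsFiniteMeasure ((volume : Measure R3).comap ((↑) : D → R3)) := by
    refine ⟨?_⟩
    rw [(MeasurableEmbedding.subtype_coe hDm).comap_apply]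
    exact (measure_mono (by simpa using hD)).trans_lt
      (isCompact_closedBall (0 : R3) R).measure_lt_top
  -- The datum of the pair `A = h₀ a`, `v = Â`, whose planar curl is `h₀` times Lebesgue measure; as
  -- `h₀ ≥ 0` the negative part is zero.
  refine ⟨0, 0, h₀.toNNReal • (volume : Measure R3).comap ((↑) : D → R3), 0, MemLp.zero,
    MemLp.zero, by simp, inferInstance, inferInstance, fun φ hφ => ?_⟩
  have h1 : ∫ x in D, φ x = ∫ x, φ x := setIntegral_eq_integral_of_forall_compl_eq_zero
    fun x hx => image_eq_zero_of_notMem_tsupport fun h => hx (hφ.2.2 h)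
  rw [integral_smul_nnreal_measure, integral_subtype_comap hDm, h1, integral_const_mul]
  simp [NNReal.smul_def, hh₀]

theorem reducedEnergy_lt_top {D : Set R3} {h₀ : ℝ} {w : R3 → R2} {B : R3 → R3} {p q : Measure D}
    (h : Admissible D h₀ w B p q) : reducedEnergy D w B p q < ⊤ := by
  have := h.finite_pos
  have := h.finite_neg
  have h1 := ENNReal.pow_lt_top (n := 2) h.memLp_fst.2
  have h2 := ENNReal.pow_lt_top (n := 2) h.memLp_snd.2
  rw [eLpNorm_two_sq] at h1 h2
  exact ENNReal.add_lt_top.2 ⟨ENNReal.add_lt_top.2 ⟨h1, ENNReal.add_lt_top.2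
    ⟨measure_lt_top _ _, measure_lt_top _ _⟩⟩, h2⟩

theorem exists_tendsto_ultrafilter_ennreal (U : Ultrafilter ℕ) (a : ℕ → ℝ≥0∞) :
    ∃ l, Tendsto a U (𝓝 l) := by
  obtain ⟨l, -, hl⟩ := isCompact_univ.ultrafilter_le_nhds (U.map a) (by simp)
  exact ⟨l, hl⟩

/-- The reduced problem has a solution. -/
theorem exists_reducedEnergy_minimizer {D : Set R3} (hDo : IsOpen D) {R : ℝ}
    (hD : D ⊆ Metric.closedBall 0 R) {h₀ : ℝ} (hh₀ : 0 ≤ h₀) :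
    ∃ w B p q, Admissible D h₀ w B p q ∧ ∀ w' B' p' q', Admissible D h₀ w' B' p' q' →
      reducedEnergy D w B p q ≤ reducedEnergy D w' B' p' q' := by
  have : LocallyCompactSpace D := hDo.locallyCompactSpace
  let S : Set ℝ≥0∞ := {e | ∃ w B p q, Admissible D h₀ w B p q ∧ reducedEnergy D w B p q = e}
  have hS : S.Nonempty :=
    let ⟨w, B, p, q, h⟩ := exists_admissible hDo.measurableSet hD hh₀
    ⟨_, w, B, p, q, h, rfl⟩
  obtain ⟨e, hanti, hlim, hmem⟩ := exists_seq_tendsto_sInf hS (OrderBot.bddBelow S)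
  choose w B p q hadm he using hmem
  set U : Ultrafilter ℕ := hyperfilter ℕ
  have hU : (U : Filter ℕ) ≤ atTop := Nat.hyperfilter_le_atTop
  set M := e 0 with hMdef
  have hM : M < ⊤ := by rw [hMdef, ← he 0]; exact reducedEnergy_lt_top (hadm 0)
  have hle : ∀ n, reducedEnergy D (w n) (B n) (p n) (q n) ≤ M := fun n =>
    (he n).trans_le (hanti (Nat.zero_le n))
  have hwM : ∀ n, ∫⁻ x in D, ‖w n x‖ₑ ^ 2 ≤ M := fun n =>
    (le_self_add.trans le_self_add).trans (hle n)
  have hpM : ∀ n, p n Set.univ ≤ M := fun n =>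
    ((le_self_add.trans le_add_self).trans le_self_add).trans (hle n)
  have hqM : ∀ n, q n Set.univ ≤ M := fun n =>
    ((le_add_self.trans le_add_self).trans le_self_add).trans (hle n)
  have hBM : ∀ n, ∫⁻ x, ‖B n x‖ₑ ^ 2 ≤ M := fun n => le_add_self.trans (hle n)
  obtain ⟨w', hw', hwlim, hwle⟩ := exists_weak_limit_L2 (U := U) (fun n => (hadm n).memLp_fst)
    hM hwM
  obtain ⟨B', hB', hBlim, hBle⟩ := exists_weak_limit_L2 (U := U) (fun n => (hadm n).memLp_snd)
    hM hBM
  obtain ⟨p', hplim, hple⟩ := exists_measure_tendsto_ultrafilter (U := U) hM hpM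
  obtain ⟨q', hqlim, hqle⟩ := exists_measure_tendsto_ultrafilter (U := U) hM hqM
  obtain ⟨a, ha⟩ := exists_tendsto_ultrafilter_ennreal U fun n => ∫⁻ x in D, ‖w n x‖ₑ ^ 2
  obtain ⟨b, hb⟩ := exists_tendsto_ultrafilter_ennreal U fun n => p n Set.univ
  obtain ⟨c, hc⟩ := exists_tendsto_ultrafilter_ennreal U fun n => q n Set.univ
  obtain ⟨d, hd⟩ := exists_tendsto_ultrafilter_ennreal U fun n => ∫⁻ x, ‖B n x‖ₑ ^ 2
  -- The four terms have separate limits along the ultrafilter, and their sum must be the limit of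
  -- the minimizing energies.
  have hsum : a + (b + c) + d = sInf S := by
    refine tendsto_nhds_unique ((ha.add (hb.add hc)).add hd) ?_
    have h1 := hlim.mono_left hU
    rw [← funext he] at h1
    exact h1
  refine ⟨w', B', p', q', ⟨hw', hB', fun φ hφ => ?_, ?_, ?_, fun φ hφ => ?_⟩, ?_⟩
  · refine tendsto_nhds_unique (hBlim _ (hφ.memLp_grad 2)) ?_
    simp only [fun n => (hadm n).div_free φ hφ]
    exact tendsto_const_nhds
  · exact ⟨((hple b hb).trans (le_of_tendsto' hb hpM)).trans_lt hM⟩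
  · exact ⟨((hqle c hc).trans (le_of_tendsto' hc hqM)).trans_lt hM⟩
  · have hcs : HasCompactSupport fun x : D => φ x := by
      refine HasCompactSupport.intro (K := ((↑) : D → R3) ⁻¹' tsupport φ) ?_
        fun x hx => image_eq_zero_of_notMem_tsupport hx
      exact Topology.IsInducing.subtypeVal.isCompact_preimage' hφ.2.1
        (by simpa using hφ.2.2)
    have hcont : Continuous fun x : D => φ x := hφ.continuous.comp continuous_subtype_val
    -- Each side is a sum of pairings with fixed test objects, so the linear curl constraint passes
    -- to the weak limit.
    refine tendsto_nhds_unique ((hplim _ hcont hcs).sub (hqlim _ hcont hcs)) ?_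
    simp only [fun n => (hadm n).curl_eq φ hφ]
    exact ((hwlim _ ((memLp_rotGrad hφ 2).restrict D)).add
      (hBlim _ (MemLp.smul_e3 (hφ.memLp 2)))).add_const _
  · intro w'' B'' p'' q'' h
    calc reducedEnergy D w' B' p' q' ≤ a + (b + c) + d :=
          add_le_add (add_le_add (hwle a ha) (add_le_add (hple b hb) (hqle c hc))) (hBle d hd)
      _ = sInf S := hsum
      _ ≤ _ := sInf_le ⟨_, _, _, _, h, rfl⟩

end LawrenceDoniach

theorem proposition2p1 (Ω : Set LawrenceDoniach.R2) (hΩ_open : IsOpen Ω)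
    (hΩ_bdd : Bornology.IsBounded Ω) (L : ℝ) (hL : 0 < L) (h₀ : ℝ) (hh₀ : 0 ≤ h₀) :
    ∃ m : ℝ≥0,
      IsLeast (LawrenceDoniach.limitEnergy (LawrenceDoniach.cylinder Ω L) h₀ ''
        (LawrenceDoniach.spaceV (LawrenceDoniach.cylinder Ω L) ×ˢ LawrenceDoniach.spaceE h₀))
        (m : ℝ≥0∞) ∧
      IsLeast (LawrenceDoniach.limitEnergy (LawrenceDoniach.cylinder Ω L) h₀ ''
        (LawrenceDoniach.spaceV (LawrenceDoniach.cylinder Ω L) ×ˢ LawrenceDoniach.spaceK h₀))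
        (m : ℝ≥0∞) := by
  obtain ⟨R, hR⟩ := LawrenceDoniach.exists_cylinder_subset_closedBall hΩ_bdd L
  obtain ⟨w, B, p, q, hadm, hmin⟩ := LawrenceDoniach.exists_reducedEnergy_minimizer
    (LawrenceDoniach.cylinder_isOpen hΩ_open L) hR hh₀
  obtain ⟨v, hv, A, hA, hle⟩ := hadm.exists_mem hR
  have hlower : ∀ x ∈ LawrenceDoniach.limitEnergy (LawrenceDoniach.cylinder Ω L) h₀ ''
      (LawrenceDoniach.spaceV (LawrenceDoniach.cylinder Ω L) ×ˢ LawrenceDoniach.spaceE h₀),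
      LawrenceDoniach.limitEnergy (LawrenceDoniach.cylinder Ω L) h₀ (v, A) ≤ x := by
    rintro _ ⟨⟨v', A'⟩, ⟨hv', hA'⟩, rfl⟩
    refine hle.trans ?_
    unfold LawrenceDoniach.limitEnergy
    refine mul_le_mul_right ?_ _
    unfold LawrenceDoniach.curlVariation
    -- Pulling the infimum over curl measures outside the energy lets each such measure be compared
    -- through its own reduced datum.
    simp only [ENNReal.add_iInf, ENNReal.iInf_add]
    exact le_iInf₂ fun μ hμ => hmin _ _ _ _ (LawrenceDoniach.admissible_of_mem hR hv'.1 hA' hμ)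
  have hfin : LawrenceDoniach.limitEnergy (LawrenceDoniach.cylinder Ω L) h₀ (v, A) ≠ ⊤ :=
    (hle.trans_lt (ENNReal.mul_lt_top (by simp)
      (LawrenceDoniach.reducedEnergy_lt_top hadm))).ne
  refine ⟨(LawrenceDoniach.limitEnergy (LawrenceDoniach.cylinder Ω L) h₀ (v, A)).toNNReal, ?_⟩
  rw [ENNReal.coe_toNNReal hfin]
  -- One pair, with `A` in `K₀ ⊆ E₀`, attains both minima.
  exact ⟨⟨⟨(v, A), ⟨hv, hA.1⟩, rfl⟩, hlower⟩, ⟨⟨(v, A), ⟨hv, hA⟩, rfl⟩,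
    fun x hx => hlower x (Set.image_mono (Set.prod_mono_right fun _ h => h.1) hx)⟩⟩
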